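/- Let $L(sl_2)=\mathbb{C}[t,t^{-1}]\otimes sl_2(\mathbb{C})$, with generators $x_k^+=t^k\otimes e$, $x_k^-=t^k\otimes f$, $h_k=t^k\otimes h$ ($k\in\mathbb{Z}$), and write $X^{(n)}=X^n/n!$. Let $V$ be a finite-dimensional representation of $L(sl_2)$ over $\mathbb{C}$ generated by a highest weight vector $\Omega\neq 0$, i.e. $x_k^+\Omega=0$ and $h_k\Omega\in\mathbb{C}\,\Omega$ for all $k\in\mathbb{Z}$. Let $a_1\neq a_2$ be complex numbers and suppose that the evaluation parameters of $\Omega$, listed with multiplicity, are $a_1,a_1,a_2$; that is, $h_0\Omega=3\Omega$ and, with $(x_0^+)^{(k)}(x_1^-)^{(k)}\Omega=\lambda_k\Omega$ for $0\le k\le 3$, $$\sum_{k=0}^{3}\lambda_k(-u)^k=(1-a_1u)^2(1-a_2u).$$ Put $\rho_1=x_1^- -a_2x_0^-$, $\rho_2=x_1^- -a_1x_0^-$ and $w_1=x_2^-(a_1,a_2)=x_2^- -(a_1+a_2)x_1^- +a_1a_2x_0^-$. Then: 1. $V$ is reducible, indecomposable and of dimension $2^3=8$ if and only if $w_1\Omega\neq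 0$. 2. $V$ is irreducible and of dimension $6$ if and only if $w_1\Omega=0$. 3. $V$ is the direct sum of its four sectors (eigenspaces of $h_0$) $h_0=3,1,-1,-3$. 4. If $w_1\Omega\neq0$, these sectors have, respectively, the bases $\{\Omega\}$; $\{\rho_1\Omega,\rho_2\Omega,w_1\Omega\}$; $\{\rho_1^2\Omega,\rho_1\rho_2\Omega,\rho_2w_1\Omega\}$; $\{\rho_1^2\rho_2\Omega\}$. 5. If $w_1\Omega=0$, these sectors have, respectively, the bases $\{\Omega\}$; $\{\rho_1\Omega,\rho_2\Omega\}$; $\{\rho_1^2\Omega,\rho_1\rho_2\Omega\}$; $\{\rho_1^2\rho_2\Omega\}$. -/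

import Mathlib

open scoped TensorProduct Polynomial

noncomputable section

namespace LoopSL2

/-- The loop algebra `L(sl₂) = ℂ[t, t⁻¹] ⊗ sl₂(ℂ)`. -/
abbrev LSL2 : Type :=
  LieAlgebra.loopAlgebra ℂ ℤ (LieAlgebra.SpecialLinear.sl (Fin 2) ℂ)

/-- The generator `x⁺ₖ = tᵏ ⊗ e`. -/
def xp (k : ℤ) : LSL2 :=
  AddMonoidAlgebra.single k 1 ⊗ₜ[ℂ]
    LieAlgebra.SpecialLinear.single (0 : Fin 2) 1 (by decide) (1 : ℂ)

/-- The generator `x⁻ₖ = tᵏ ⊗ f`. -/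
def xm (k : ℤ) : LSL2 :=
  AddMonoidAlgebra.single k 1 ⊗ₜ[ℂ]
    LieAlgebra.SpecialLinear.single (1 : Fin 2) 0 (by decide) (1 : ℂ)

/-- The generator `hₖ = tᵏ ⊗ h`. -/
def hh (k : ℤ) : LSL2 :=
  AddMonoidAlgebra.single k 1 ⊗ₜ[ℂ]
    LieAlgebra.SpecialLinear.singleSubSingle (0 : Fin 2) 1 (1 : ℂ)

/-- For a family `g` of generators and a multiset `A` of `m` parameters, the generator with
parameters `g_m(A) = ∑_{k=0}^{m} (-1)ᵏ e_k(A) g_{m-k}`, where `e_k` is the `k`-th elementary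
symmetric function. -/
def withParams (g : ℤ → LSL2) (A : Multiset ℂ) : LSL2 :=
  ∑ k ∈ Finset.range (A.card + 1),
    ((-1 : ℂ) ^ k * A.esymm k) • g ((A.card : ℤ) - (k : ℤ))

section Rep

variable {V : Type*} [AddCommGroup V] [Module ℂ V] [LieRingModule LSL2 V] [LieModule ℂ LSL2 V]

/-- The divided power `X⁽ⁿ⁾ = Xⁿ / n!` of `X`, acting on `V`. -/
def divPow (V : Type*) [AddCommGroup V] [Module ℂ V] [LieRingModule LSL2 V] [LieModule ℂ LSL2 V]
    (X : LSL2) (n : ℕ) : Module.End ℂ V :=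
  ((n.factorial : ℂ)⁻¹) • (LieModule.toEnd ℂ LSL2 V X) ^ n

/-- `Ω` is a highest weight vector: a nonzero vector annihilated by all `x⁺ₖ` that is a
simultaneous eigenvector of all `hₖ`. -/
structure IsHighestWeightVector (Ω : V) : Prop where
  ne_zero : Ω ≠ 0
  xp_lie : ∀ k : ℤ, ⁅xp k, Ω⁆ = 0
  hh_lie : ∃ d : ℤ → ℂ, ∀ k : ℤ, ⁅hh k, Ω⁆ = d k • Ω

/-- `A` is the multiset of evaluation parameters of `Ω`, listed with multiplicity: its cardinality
`r` is the eigenvalue of `h₀` on `Ω`, and if `λ_k` is the eigenvalue of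
`(x⁺₀)⁽ᵏ⁾ (x⁻₁)⁽ᵏ⁾` on `Ω`, then `∑_{k=0}^{r} λ_k (-u)ᵏ = ∏_{a ∈ A} (1 - a u)`. -/
def HasEvaluationParameters (Ω : V) (A : Multiset ℂ) : Prop :=
  ⁅hh 0, Ω⁆ = (A.card : ℂ) • Ω ∧
    ∃ lam : ℕ → ℂ,
      (∀ k ≤ A.card, divPow V (xp 0) k (divPow V (xm 1) k Ω) = lam k • Ω) ∧
      ∑ k ∈ Finset.range (A.card + 1), Polynomial.C (lam k) * (-Polynomial.X) ^ k =
        (A.map fun a => (1 - Polynomial.C a * Polynomial.X : ℂ[X])).prod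

/-- The sector of `h₀ = c` in `V`. -/
def sector (V : Type*) [AddCommGroup V] [Module ℂ V] [LieRingModule LSL2 V] [LieModule ℂ LSL2 V]
    (c : ℂ) : Submodule ℂ V :=
  Module.End.eigenspace (LieModule.toEnd ℂ LSL2 V (hh 0)) c

/-- The representation `V` is reducible: it has a subrepresentation other than `0` and `V`. -/
def IsReducible (V : Type*) [AddCommGroup V] [Module ℂ V] [LieRingModule LSL2 V]
    [LieModule ℂ LSL2 V] : Prop :=
  ∃ N : LieSubmodule ℂ LSL2 V, N ≠ ⊥ ∧ N ≠ ⊤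

/-- The representation `V` is indecomposable: it is nonzero and is not the direct sum of two
nonzero subrepresentations. -/
def IsIndecomposable (V : Type*) [AddCommGroup V] [Module ℂ V] [LieRingModule LSL2 V]
    [LieModule ℂ LSL2 V] : Prop :=
  Nontrivial V ∧ ∀ N N' : LieSubmodule ℂ LSL2 V, IsCompl N N' → N = ⊥ ∨ N' = ⊥

end Rep

/-- The family `b` of vectors of `V` is a basis of the subspace `W`. -/
def IsBasisOf {V ι : Type*} [AddCommGroup V] [Module ℂ V] (b : ι → V) (W : Submodule ℂ V) : Prop :=
  LinearIndependent ℂ b ∧ Submodule.span ℂ (Set.range b) = W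

end LoopSL2

end

/-! By Garland's identity, `(x₀⁺)⁽ⁿ⁾ (x₁⁻)⁽ⁿ⁺¹⁾ Ω` is a combination of the `xₖ⁻ Ω`. Applied to all
`n`, it says that `hₖ` acts on `Ω` by the `k`-th power sum of the parameters `A` and that
`∏_{a ∈ A} (t - a) ⊗ f` kills `Ω`. Hence the sector `1` is the quotient of `ℂ[t, t⁻¹]` by the
ideal of the `p` with `(p ⊗ f) Ω = 0`, which contains `(t - a₁)² (t - a₂)` and is contained in
the ideal of `(t - a₁) (t - a₂)`; the vector `w₁ Ω` decides which of these two ideals it is.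
If `w₁ Ω ≠ 0`, it is itself a highest weight vector, so it generates a proper
subrepresentation. If `w₁ Ω = 0`, no nonzero vector of the sector `1` is killed by all `xₖ⁺`,
so that every nonzero subrepresentation contains `Ω`. Finally `sl₂`-theory bounds the
dimension of the sector `-n` by that of the sector `n`, so linearly independent families of
the right size are bases.
-/

namespace LoopSL2

noncomputable section

open LaurentPolynomial LieModule
open Finset.HasAntidiagonal (antidiagonal)

section Commutators

variable {R : Type*} [Ring R] {e f h : R}

theorem mul_pow_succ_sub_of_commute (hcomm : Commute e (h * e - e * h)) (n : ℕ) :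
    h * e ^ (n + 1) - e ^ (n + 1) * h = (n + 1) • (e ^ n * (h * e - e * h)) := by
  induction n with
  | zero => simp
  | succ n ih =>
    calc h * e ^ (n + 2) - e ^ (n + 2) * h
        = (h * e - e * h) * e ^ (n + 1) + e * (h * e ^ (n + 1) - e ^ (n + 1) * h) := by
          rw [pow_succ' e (n + 1)]
          noncomm_ring
      _ = (n + 1 + 1) • (e ^ (n + 1) * (h * e - e * h)) := by
          rw [ih, ← (hcomm.pow_left (n + 1)).eq, mul_smul_comm, ← mul_assoc, ← pow_succ']
          module

-- The terms with `h` on the left and on the right are averaged: hence the factor `2`, and `e ↔ f`,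
-- `h ↔ -h` becomes a symmetry of the formula.
theorem two_nsmul_pow_succ_mul_sub (hef : e * f - f * e = h)
    (hcomm : Commute e (h * e - e * h)) (n : ℕ) :
    2 • (e ^ (n + 1) * f - f * e ^ (n + 1)) = (n + 1) • (h * e ^ n + e ^ n * h) := by
  induction n with
  | zero => simp [hef, two_mul]
  | succ n ih =>
    have hehe : e * h * e ^ n = h * e ^ (n + 1) - e ^ n * (h * e - e * h) := by
      rw [(hcomm.pow_left n).eq, pow_succ']
      noncomm_ring
    calc 2 • (e ^ (n + 2) * f - f * e ^ (n + 2))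
        = e * (2 • (e ^ (n + 1) * f - f * e ^ (n + 1))) + 2 • (h * e ^ (n + 1)) := by
          rw [← hef, pow_succ' e (n + 1)]
          noncomm_ring
      _ = (n + 1) • (h * e ^ (n + 1) + e ^ (n + 1) * h) - (n + 1) • (e ^ n * (h * e - e * h))
            + 2 • (h * e ^ (n + 1)) := by
          rw [ih, mul_smul_comm, mul_add, ← mul_assoc, hehe, ← mul_assoc, ← pow_succ']
          module
      _ = (n + 1 + 1) • (h * e ^ (n + 1) + e ^ (n + 1) * h) := by
          rw [← mul_pow_succ_sub_of_commute hcomm]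
          module

theorem two_nsmul_mul_pow_succ_sub (hef : e * f - f * e = h)
    (hcomm : Commute f (h * f - f * h)) (n : ℕ) :
    2 • (e * f ^ (n + 1) - f ^ (n + 1) * e) = (n + 1) • (h * f ^ n + f ^ n * h) := by
  have hfe : f * e - e * f = -h := by rw [← hef, neg_sub]
  have hcomm' : Commute f (-h * f - f * -h) := by
    simpa [neg_add_eq_sub, sub_eq_add_neg, add_comm] using hcomm.neg_right
  have key := congrArg Neg.neg (two_nsmul_pow_succ_mul_sub hfe hcomm' n)
  simpa only [← smul_neg, neg_sub, neg_add, neg_mul, mul_neg, neg_neg] using key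

end Commutators

section Sl2

variable {R L M : Type*} [CommRing R] [IsDomain R] [CharZero R] [LieRing L] [LieAlgebra R L]
  [AddCommGroup M] [Module R M] [Module.IsTorsionFree R M] [LieRingModule L M] [LieModule R L M]
  {h e f : L}

theorem pow_succ_toEnd_lie_eq_zero (t : IsSl2Triple h e f) {μ : R} {v : M} (hv : ⁅h, v⁆ = μ • v)
    {n : ℕ} (hn : (toEnd R L M e ^ n) v = 0) : (toEnd R L M e ^ (n + 1)) ⁅f, v⁆ = 0 := by
  have : IsAddTorsionFree M := .of_isTorsionFree R M
  have hEF : toEnd R L M e * toEnd R L M f - toEnd R L M f * toEnd R L M e = toEnd R L M h := by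
    ext m
    simp [← t.lie_e_f]
  have hHE : toEnd R L M h * toEnd R L M e - toEnd R L M e * toEnd R L M h
      = 2 • toEnd R L M e := by
    ext m
    simp [← lie_lie, t.lie_h_e_nsmul]
  have hcomm := (Commute.refl (toEnd R L M e)).smul_right 2
  rw [← hHE] at hcomm
  have hEn : (toEnd R L M e ^ (n + 1)) v = 0 := by
    rw [pow_succ', Module.End.mul_apply, hn, map_zero]
  simpa [hn, hEn, hv] using congrArg (· v) (two_nsmul_pow_succ_mul_sub hEF hcomm n)

theorem pow_add_toEnd_pow_eq_zero (t : IsSl2Triple h e f) {μ : R} {v : M} (hv : ⁅h, v⁆ = μ • v)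
    {n : ℕ} (hn : (toEnd R L M e ^ n) v = 0) (p : ℕ) :
    (toEnd R L M e ^ (n + p)) ((toEnd R L M f ^ p) v) = 0 := by
  induction p with
  | zero => simpa using hn
  | succ p ih =>
    have hp : ⁅h, (toEnd R L M f ^ p) v⁆ = (μ - 2 * p) • (toEnd R L M f ^ p) v := by
      have := t.symm.lie_h_pow_toEnd_e (by rw [neg_lie, hv, neg_smul] : ⁅-h, v⁆ = -μ • v) p
      rw [neg_lie, neg_eq_iff_eq_neg] at this
      rw [this]
      module
    simpa [pow_succ' (toEnd R L M f), add_assoc] using pow_succ_toEnd_lie_eq_zero t hp ih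

variable [IsNoetherian R M]

theorem exists_pow_toEnd_eq_zero (t : IsSl2Triple h e f) {μ : R} {v : M} (hv : ⁅h, v⁆ = μ • v) :
    ∃ n : ℕ, (toEnd R L M e ^ n) v = 0 := by
  by_contra! hne
  have hinj : Function.Injective fun n : ℕ => μ + 2 * (n : R) := fun a b hab => by simpa using hab
  have hli := (toEnd R L M h).eigenvectors_linearIndependent' _ hinj
    (fun n => (toEnd R L M e ^ n) v) fun n => by
      rw [Module.End.hasEigenvector_iff, Module.End.mem_eigenspace_iff]
      exact ⟨t.lie_h_pow_toEnd_e hv n, hne n⟩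
  have := hli.finite
  exact not_finite ℕ

theorem pow_toEnd_ne_zero_of_lie_eq_neg_smul (t : IsSl2Triple h e f) {n : ℕ} {v : M} (hv0 : v ≠ 0)
    (hv : ⁅h, v⁆ = -(n : R) • v) : (toEnd R L M e ^ n) v ≠ 0 := by
  intro h0
  have hv' : ⁅-h, v⁆ = (n : R) • v := by rw [neg_lie, hv, neg_smul, neg_neg]
  obtain ⟨p, hp, hp'⟩ := Nat.exists_not_and_succ_of_not_zero_of_exists (by simpa using hv0)
    (exists_pow_toEnd_eq_zero t.symm hv')
  have P : t.symm.HasPrimitiveVectorWith ((toEnd R L M f ^ p) v) ((n + 2 * p : ℕ) : R) := by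
    refine ⟨hp, ?_, by rwa [pow_succ', Module.End.mul_apply] at hp'⟩
    rw [t.symm.lie_h_pow_toEnd_e hv' p]
    push_cast
    rfl
  exact P.pow_toEnd_f_ne_zero_of_eq_nat rfl (i := n + p) (by lia)
    (pow_add_toEnd_pow_eq_zero t hv h0 p)

end Sl2

section LoopAlgebra

/-- The element `q ⊗ e` of the loop algebra. -/
def raise : ℂ[T;T⁻¹] →ₗ[ℂ] LSL2 :=
  (TensorProduct.mk ℂ ℂ[T;T⁻¹] _).flip
    (LieAlgebra.SpecialLinear.single (0 : Fin 2) 1 (by decide) (1 : ℂ))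

/-- The element `q ⊗ f` of the loop algebra. -/
def lower : ℂ[T;T⁻¹] →ₗ[ℂ] LSL2 :=
  (TensorProduct.mk ℂ ℂ[T;T⁻¹] _).flip
    (LieAlgebra.SpecialLinear.single (1 : Fin 2) 0 (by decide) (1 : ℂ))

/-- The element `q ⊗ h` of the loop algebra. -/
def cartan : ℂ[T;T⁻¹] →ₗ[ℂ] LSL2 :=
  (TensorProduct.mk ℂ ℂ[T;T⁻¹] _).flip
    (LieAlgebra.SpecialLinear.singleSubSingle (0 : Fin 2) 1 (1 : ℂ))

theorem xm_eq_lower (k : ℤ) : xm k = lower (T k) := rfl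

theorem hh_zero_eq_cartan_one : hh 0 = cartan 1 := rfl

theorem isSl2Triple_specialLinear :
    IsSl2Triple (LieAlgebra.SpecialLinear.singleSubSingle (0 : Fin 2) 1 (1 : ℂ))
      (LieAlgebra.SpecialLinear.single (0 : Fin 2) 1 (by decide) (1 : ℂ))
      (LieAlgebra.SpecialLinear.single (1 : Fin 2) 0 (by decide) (1 : ℂ)) where
  h_ne_zero h := by
    have := congrArg (fun A : LieAlgebra.SpecialLinear.sl (Fin 2) ℂ => A.val 0 0) h
    simp [Matrix.single] at this
  lie_e_f := by
    ext i j
    rw [LieAlgebra.SpecialLinear.sl_bracket]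
    fin_cases i <;> fin_cases j <;> simp [Matrix.mul_apply, Matrix.single]
  lie_h_e_nsmul := by
    ext i j
    rw [LieAlgebra.SpecialLinear.sl_bracket]
    fin_cases i <;> fin_cases j <;> norm_num [Matrix.mul_apply, Matrix.single, Matrix.sub_apply]
  lie_h_f_nsmul := by
    ext i j
    rw [LieAlgebra.SpecialLinear.sl_bracket]
    fin_cases i <;> fin_cases j <;> norm_num [Matrix.mul_apply, Matrix.single, Matrix.sub_apply]

theorem raise_lie_lower (q r : ℂ[T;T⁻¹]) : ⁅raise q, lower r⁆ = cartan (q * r) :=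
  congrArg (TensorProduct.mk ℂ ℂ[T;T⁻¹] _ (q * r)) isSl2Triple_specialLinear.lie_e_f

theorem cartan_lie_raise (q r : ℂ[T;T⁻¹]) : ⁅cartan q, raise r⁆ = (2 : ℂ) • raise (q * r) :=
  (congrArg (TensorProduct.mk ℂ ℂ[T;T⁻¹] _ (q * r))
    (isSl2Triple_specialLinear.lie_h_e_smul ℂ)).trans (map_smul _ _ _)

theorem cartan_lie_lower (q r : ℂ[T;T⁻¹]) : ⁅cartan q, lower r⁆ = (-2 : ℂ) • lower (q * r) :=
  (congrArg (TensorProduct.mk ℂ ℂ[T;T⁻¹] _ (q * r))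
    ((isSl2Triple_specialLinear.lie_lie_smul_f ℂ).trans (neg_smul _ _).symm)).trans
      (map_smul _ _ _)

theorem raise_lie_raise (q r : ℂ[T;T⁻¹]) : ⁅raise q, raise r⁆ = 0 := by
  simp only [raise, LinearMap.flip_apply, TensorProduct.mk_apply,
    LieAlgebra.ExtendScalars.bracket_tmul, lie_self, TensorProduct.tmul_zero]

theorem lower_lie_lower (q r : ℂ[T;T⁻¹]) : ⁅lower q, lower r⁆ = 0 := by
  simp only [lower, LinearMap.flip_apply, TensorProduct.mk_apply,
    LieAlgebra.ExtendScalars.bracket_tmul, lie_self, TensorProduct.tmul_zero]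

theorem exists_eq_raise_add_cartan_add_lower (x : LSL2) :
    ∃ q r s, x = raise q + cartan r + lower s := by
  induction x using TensorProduct.induction_on with
  | zero => exact ⟨0, 0, 0, by simp⟩
  | add x y hx hy =>
    obtain ⟨q, r, s, rfl⟩ := hx
    obtain ⟨q', r', s', rfl⟩ := hy
    exact ⟨q + q', r + r', s + s', by simp only [map_add]; abel⟩
  | tmul p A =>
    refine ⟨A.val 0 1 • p, A.val 0 0 • p, A.val 1 0 • p, ?_⟩
    have htr : A.val 0 0 + A.val 1 1 = 0 := by
      have : Matrix.trace A.val = 0 := A.property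
      simpa [Matrix.trace, Fin.sum_univ_two] using this
    simp only [raise, lower, cartan, LinearMap.flip_apply, TensorProduct.mk_apply,
      TensorProduct.smul_tmul, ← TensorProduct.tmul_add]
    congr 1
    ext i j
    fin_cases i <;> fin_cases j <;> simp [Matrix.single]
    linear_combination htr

theorem isSl2Triple {q r : ℂ[T;T⁻¹]} (hqr : q * r = 1) :
    IsSl2Triple (hh 0) (raise q) (lower r) where
  h_ne_zero h := isSl2Triple_specialLinear.h_ne_zero <|
    (Module.FaithfullyFlat.one_tmul_eq_zero_iff ℂ _ (A := ℂ[T;T⁻¹]) _).1 h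
  lie_e_f := by rw [raise_lie_lower, hqr, hh_zero_eq_cartan_one]
  lie_h_e_nsmul := by
    rw [hh_zero_eq_cartan_one, cartan_lie_raise, one_mul, ofNat_smul_eq_nsmul]
  lie_h_f_nsmul := by
    rw [hh_zero_eq_cartan_one, cartan_lie_lower, one_mul]
    exact (neg_smul (2 : ℂ) (lower r)).trans
      (congrArg Neg.neg (ofNat_smul_eq_nsmul ℂ 2 (lower r)))

end LoopAlgebra

section Action

variable {V : Type*} [AddCommGroup V] [LieRingModule LSL2 V]

theorem raise_lower_lie (q r : ℂ[T;T⁻¹]) (v : V) :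
    ⁅raise q, ⁅lower r, v⁆⁆ = ⁅cartan (q * r), v⁆ + ⁅lower r, ⁅raise q, v⁆⁆ := by
  rw [leibniz_lie, raise_lie_lower]

theorem lower_lower_lie_comm (q r : ℂ[T;T⁻¹]) (v : V) :
    ⁅lower q, ⁅lower r, v⁆⁆ = ⁅lower r, ⁅lower q, v⁆⁆ := by
  rw [leibniz_lie, lower_lie_lower, zero_lie, zero_add]

variable [Module ℂ V] [LieModule ℂ LSL2 V]

theorem smul_loop_lie (c : ℂ) (x : LSL2) (v : V) : ⁅c • x, v⁆ = c • ⁅x, v⁆ := smul_lie c x v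

theorem cartan_lower_lie (q r : ℂ[T;T⁻¹]) (v : V) :
    ⁅cartan q, ⁅lower r, v⁆⁆ = ⁅lower r, ⁅cartan q, v⁆⁆ - (2 : ℂ) • ⁅lower (q * r), v⁆ := by
  rw [leibniz_lie, cartan_lie_lower, smul_loop_lie]
  module

theorem mem_sector {c : ℂ} {v : V} : v ∈ sector V c ↔ ⁅hh 0, v⁆ = c • v := by
  rw [sector, Module.End.mem_eigenspace_iff, toEnd_apply_apply]

theorem lie_mem_sector {x : LSL2} {k c : ℂ} {v : V} (hx : ⁅hh 0, x⁆ = k • x)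
    (hv : v ∈ sector V c) : ⁅x, v⁆ ∈ sector V (c + k) := by
  rw [mem_sector] at hv ⊢
  rw [leibniz_lie, hx, hv, lie_smul, smul_loop_lie]
  module

theorem raise_mem_sector {c : ℂ} {v : V} (hv : v ∈ sector V c) (q : ℂ[T;T⁻¹]) :
    ⁅raise q, v⁆ ∈ sector V (c + 2) :=
  lie_mem_sector (by rw [hh_zero_eq_cartan_one, cartan_lie_raise, one_mul]) hv

theorem lower_mem_sector {c : ℂ} {v : V} (hv : v ∈ sector V c) (q : ℂ[T;T⁻¹]) :
    ⁅lower q, v⁆ ∈ sector V (c - 2) := by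
  rw [sub_eq_add_neg]
  exact lie_mem_sector (by rw [hh_zero_eq_cartan_one, cartan_lie_lower, one_mul]) hv

theorem raise_pow_mem_sector {c : ℂ} {v : V} (hv : v ∈ sector V c) (q : ℂ[T;T⁻¹]) (n : ℕ) :
    (toEnd ℂ LSL2 V (raise q) ^ n) v ∈ sector V (c + 2 * n) := by
  induction n with
  | zero => simpa using hv
  | succ n ih =>
    rw [pow_succ', Module.End.mul_apply, toEnd_apply_apply]
    convert raise_mem_sector ih q using 2
    push_cast
    ring

theorem raise_pow_ne_zero [FiniteDimensional ℂ V] {n : ℕ} {v : V} (hv : v ∈ sector V (-(n : ℂ)))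
    (hv0 : v ≠ 0) : (toEnd ℂ LSL2 V (raise 1) ^ n) v ≠ 0 :=
  pow_toEnd_ne_zero_of_lie_eq_neg_smul (isSl2Triple (one_mul 1)) hv0 (mem_sector.1 hv)

end Action

section HighestWeight

variable {V : Type*} [AddCommGroup V] [Module ℂ V] [LieRingModule LSL2 V] [LieModule ℂ LSL2 V]
  {Ω : V} {d : ℂ[T;T⁻¹] →ₗ[ℂ] ℂ}

/-- `Ω` is a highest weight vector on which `q ⊗ h` acts as the scalar `d q`. -/
structure HasHighestWeight (Ω : V) (d : ℂ[T;T⁻¹] →ₗ[ℂ] ℂ) : Prop where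
  ne_zero : Ω ≠ 0
  raise_lie : ∀ q, ⁅raise q, Ω⁆ = 0
  cartan_lie : ∀ q, ⁅cartan q, Ω⁆ = d q • Ω

theorem IsHighestWeightVector.exists_hasHighestWeight (h : IsHighestWeightVector Ω) :
    ∃ d, HasHighestWeight Ω d := by
  obtain ⟨d, hd⟩ := h.hh_lie
  let T_basis : Module.Basis ℤ ℂ ℂ[T;T⁻¹] := AddMonoidAlgebra.basis ℤ ℂ
  have hT (k : ℤ) : T_basis k = T k := AddMonoidAlgebra.basis_apply ℂ k
  let orbit : LSL2 →ₗ[ℂ] V := LinearMap.flip (toEnd ℂ LSL2 V : LSL2 →ₗ[ℂ] V →ₗ[ℂ] V) Ω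
  have hraise : orbit ∘ₗ raise = 0 := T_basis.ext fun k => by rw [hT]; exact h.xp_lie k
  have hcartan : orbit ∘ₗ cartan = (T_basis.constr ℂ d).smulRight Ω := T_basis.ext fun k => by
    rw [LinearMap.smulRight_apply, T_basis.constr_basis, hT]
    exact hd k
  exact ⟨T_basis.constr ℂ d, h.ne_zero, LinearMap.congr_fun hraise, LinearMap.congr_fun hcartan⟩

variable (V) in
/-- The action of the elements `q ⊗ f` on `V`, as a bilinear map. -/
def lowerAction : ℂ[T;T⁻¹] →ₗ[ℂ] V →ₗ[ℂ] V :=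
  (toEnd ℂ LSL2 V : LSL2 →ₗ[ℂ] V →ₗ[ℂ] V) ∘ₗ lower

/-- The span of the vectors obtained from `Ω` by applying `n` elements `q ⊗ f`. -/
def lowered (Ω : V) : ℕ → Submodule ℂ V
  | 0 => Submodule.span ℂ {Ω}
  | n + 1 => Submodule.map₂ (lowerAction V) ⊤ (lowered Ω n)

theorem self_mem_lowered : Ω ∈ lowered Ω 0 := Submodule.mem_span_singleton_self Ω

theorem lower_mem_lowered {u : V} {n : ℕ} (hu : u ∈ lowered Ω n) (q : ℂ[T;T⁻¹]) :
    ⁅lower q, u⁆ ∈ lowered Ω (n + 1) :=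
  Submodule.apply_mem_map₂ (lowerAction V) Submodule.mem_top hu

theorem lowered_succ_le {n : ℕ} {W : Submodule ℂ V}
    (h : ∀ q, ∀ u ∈ lowered Ω n, ⁅lower q, u⁆ ∈ W) : lowered Ω (n + 1) ≤ W :=
  Submodule.map₂_le.2 fun q _ => h q

theorem lowered_le_sector {c : ℂ} (h : Ω ∈ sector V c) (n : ℕ) :
    lowered Ω n ≤ sector V (c - 2 * n) := by
  induction n with
  | zero => simpa [lowered] using h
  | succ n ih =>
    refine lowered_succ_le fun q u hu => ?_
    convert lower_mem_sector (ih hu) q using 2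
    push_cast
    ring

theorem mem_lowered_one {v : V} : v ∈ lowered Ω 1 ↔ ∃ p, ⁅lower p, Ω⁆ = v := by
  rw [lowered, lowered, Submodule.map₂_span_singleton_eq_map_flip, Submodule.map_top]
  exact LinearMap.mem_range

namespace HasHighestWeight

theorem mem_sector (h : HasHighestWeight Ω d) : Ω ∈ sector V (d 1) :=
  LoopSL2.mem_sector.2 (h.cartan_lie 1)

theorem cartan_mem_lowered (h : HasHighestWeight Ω d) (r : ℂ[T;T⁻¹]) {n : ℕ} {u : V}
    (hu : u ∈ lowered Ω n) : ⁅cartan r, u⁆ ∈ lowered Ω n := by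
  induction n generalizing u with
  | zero =>
    obtain ⟨c, rfl⟩ := Submodule.mem_span_singleton.1 hu
    rw [lie_smul, h.cartan_lie]
    exact Submodule.smul_mem _ _ (Submodule.smul_mem _ _ self_mem_lowered)
  | succ n ih =>
    suffices lowered Ω (n + 1) ≤ (lowered Ω (n + 1)).comap (toEnd ℂ LSL2 V (cartan r)) from this hu
    refine lowered_succ_le fun s u hu => ?_
    rw [Submodule.mem_comap, toEnd_apply_apply, cartan_lower_lie]
    exact sub_mem (lower_mem_lowered (ih hu) s) (Submodule.smul_mem _ _ (lower_mem_lowered hu _))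

theorem raise_eq_zero_of_mem_lowered_zero (h : HasHighestWeight Ω d) (q : ℂ[T;T⁻¹]) {u : V}
    (hu : u ∈ lowered Ω 0) : ⁅raise q, u⁆ = 0 := by
  obtain ⟨c, rfl⟩ := Submodule.mem_span_singleton.1 hu
  rw [lie_smul, h.raise_lie, smul_zero]

theorem raise_mem_lowered (h : HasHighestWeight Ω d) (q : ℂ[T;T⁻¹]) {n : ℕ} {u : V}
    (hu : u ∈ lowered Ω (n + 1)) : ⁅raise q, u⁆ ∈ lowered Ω n := by
  suffices lowered Ω (n + 1) ≤ (lowered Ω n).comap (toEnd ℂ LSL2 V (raise q)) from this hu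
  refine lowered_succ_le fun s u hu => ?_
  rw [Submodule.mem_comap, toEnd_apply_apply, raise_lower_lie]
  refine add_mem (h.cartan_mem_lowered _ hu) ?_
  cases n with
  | zero => simp [h.raise_eq_zero_of_mem_lowered_zero q hu]
  | succ n => exact lower_mem_lowered (h.raise_mem_lowered q hu) s

theorem lie_mem_iSup_lowered (h : HasHighestWeight Ω d) (x : LSL2) {u : V}
    (hu : u ∈ ⨆ n, lowered Ω n) : ⁅x, u⁆ ∈ ⨆ n, lowered Ω n := by
  suffices ⨆ n, lowered Ω n ≤ (⨆ n, lowered Ω n).comap (toEnd ℂ LSL2 V x) from this hu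
  refine iSup_le fun n u hu => ?_
  obtain ⟨q, r, s, rfl⟩ := exists_eq_raise_add_cartan_add_lower x
  rw [Submodule.mem_comap, toEnd_apply_apply, add_lie, add_lie]
  refine add_mem (add_mem ?_ (Submodule.mem_iSup_of_mem n (h.cartan_mem_lowered r hu)))
    (Submodule.mem_iSup_of_mem (n + 1) (lower_mem_lowered hu s))
  cases n with
  | zero => simp [h.raise_eq_zero_of_mem_lowered_zero q hu]
  | succ n => exact Submodule.mem_iSup_of_mem n (h.raise_mem_lowered q hu)

theorem lieSpan_le_iSup_lowered (h : HasHighestWeight Ω d) :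
    (LieSubmodule.lieSpan ℂ LSL2 {Ω} : LieSubmodule ℂ LSL2 V).toSubmodule ≤ ⨆ n, lowered Ω n := by
  let N : LieSubmodule ℂ LSL2 V := { ⨆ n, lowered Ω n with lie_mem := h.lie_mem_iSup_lowered _ }
  have : LieSubmodule.lieSpan ℂ LSL2 {Ω} ≤ N := by
    rw [LieSubmodule.lieSpan_le, Set.singleton_subset_iff]
    exact Submodule.mem_iSup_of_mem (p := lowered Ω) 0 self_mem_lowered
  exact this

section Generated

variable (hgen : LieSubmodule.lieSpan ℂ LSL2 {Ω} = (⊤ : LieSubmodule ℂ LSL2 V))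

include hgen

theorem iSup_lowered_eq_top (h : HasHighestWeight Ω d) : ⨆ n, lowered Ω n = ⊤ := by
  have := h.lieSpan_le_iSup_lowered
  rw [hgen] at this
  exact top_le_iff.1 this

theorem sector_eq_lowered (h : HasHighestWeight Ω d) (n : ℕ) :
    sector V (d 1 - 2 * n) = lowered Ω n := by
  have hindep : iSupIndep fun n : ℕ => sector V (d 1 - 2 * n) :=
    (toEnd ℂ LSL2 V (hh 0)).eigenspaces_iSupIndep.comp fun m n hmn => by simpa using hmn
  exact (congrFun ((hindep.le_iff_eq_of_iSup_eq_top (h.iSup_lowered_eq_top hgen)).1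
    (lowered_le_sector h.mem_sector)) n).symm

theorem sector_eq_bot (h : HasHighestWeight Ω d) {c : ℂ} (hc : ∀ n : ℕ, c ≠ d 1 - 2 * n) :
    sector V c = ⊥ := by
  refine disjoint_top.1 (((toEnd ℂ LSL2 V (hh 0)).eigenspaces_iSupIndep c).mono_right ?_)
  rw [← h.iSup_lowered_eq_top hgen]
  exact iSup_le fun n => (lowered_le_sector h.mem_sector n).trans <|
    le_iSup₂_of_le (d 1 - 2 * n) (hc n).symm le_rfl

theorem eq_top_of_mem_sector (h : HasHighestWeight Ω d) {N : LieSubmodule ℂ LSL2 V} {v : V}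
    (hvN : v ∈ N) (hv0 : v ≠ 0) (hv : v ∈ sector V (d 1)) : N = ⊤ := by
  have hv' : v ∈ lowered Ω 0 := by simpa using (h.sector_eq_lowered hgen 0).le (by simpa using hv)
  obtain ⟨c, rfl⟩ := Submodule.mem_span_singleton.1 hv'
  rw [eq_top_iff, ← hgen, LieSubmodule.lieSpan_le, Set.singleton_subset_iff]
  exact (N.toSubmodule.smul_mem_iff (left_ne_zero_of_smul hv0)).1 hvN

theorem isIndecomposable (h : HasHighestWeight Ω d) : IsIndecomposable V := by
  refine ⟨⟨Ω, 0, h.ne_zero⟩, fun N N' hN => ?_⟩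
  obtain ⟨u, hu, u', hu', hsum⟩ :=
    (LieSubmodule.mem_sup N N' Ω).1 (hN.sup_eq_top ▸ LieSubmodule.mem_top Ω)
  have hdiff : ⁅hh 0, u⁆ - d 1 • u = d 1 • u' - ⁅hh 0, u'⁆ := by
    rw [sub_eq_sub_iff_add_eq_add, ← lie_add, ← smul_add, add_comm u', hsum]
    exact h.cartan_lie 1
  have hzero : ⁅hh 0, u⁆ - d 1 • u = 0 := by
    have hmem : ⁅hh 0, u⁆ - d 1 • u ∈ N := sub_mem (N.lie_mem hu) (N.smul_mem _ hu)
    have hmem' : ⁅hh 0, u⁆ - d 1 • u ∈ N' :=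
      hdiff ▸ sub_mem (N'.smul_mem _ hu') (N'.lie_mem hu')
    exact (LieSubmodule.mem_bot _).1 (hN.inf_eq_bot.le ⟨hmem, hmem'⟩)
  by_cases hu0 : u = 0
  · rw [hu0, zero_add] at hsum
    subst hsum
    rw [h.eq_top_of_mem_sector hgen hu' h.ne_zero h.mem_sector] at hN
    exact .inl (eq_bot_of_isCompl_top hN)
  · rw [h.eq_top_of_mem_sector hgen hu hu0 (LoopSL2.mem_sector.2 (sub_eq_zero.1 hzero))] at hN
    exact .inr (eq_bot_of_top_isCompl hN)

theorem iSup_sector_eq_top (h : HasHighestWeight Ω d) : ⨆ c, sector V c = ⊤ := by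
  rw [eq_top_iff, ← h.iSup_lowered_eq_top hgen]
  exact iSup_mono' fun n => ⟨d 1 - 2 * n, lowered_le_sector h.mem_sector n⟩

variable [FiniteDimensional ℂ V] {N : ℕ} (hN : d 1 = N)

include hN

theorem lowered_eq_bot (h : HasHighestWeight Ω d) {n : ℕ} (hn : N < n) : lowered Ω n = ⊥ := by
  rw [Submodule.eq_bot_iff]
  by_contra! ⟨u, hu, hu0⟩
  obtain ⟨k, rfl⟩ := Nat.exists_eq_add_of_lt hn
  have hsec : u ∈ sector V (-((N + 2 * (k + 1) : ℕ) : ℂ)) := by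
    convert lowered_le_sector h.mem_sector _ hu using 2
    rw [hN]
    push_cast
    ring
  have hbot : sector V (-((N + 2 * (k + 1) : ℕ) : ℂ) + 2 * (N + 2 * (k + 1) : ℕ)) = ⊥ := by
    refine h.sector_eq_bot hgen fun m hm => ?_
    have : (2 * (k + 1) + 2 * m : ℂ) = 0 := by
      rw [hN] at hm
      push_cast at hm
      linear_combination hm
    norm_cast at this
    lia
  have := raise_pow_mem_sector hsec 1 (N + 2 * (k + 1))
  rw [hbot, Submodule.mem_bot] at this
  exact raise_pow_ne_zero hsec hu0 this

theorem isInternal_sector (h : HasHighestWeight Ω d) :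
    DirectSum.IsInternal fun n : Fin (N + 1) => sector V (N - 2 * ((n : ℕ) : ℂ)) := by
  rw [DirectSum.isInternal_submodule_iff_iSupIndep_and_iSup_eq_top]
  refine ⟨(toEnd ℂ LSL2 V (hh 0)).eigenspaces_iSupIndep.comp fun m n hmn => ?_, ?_⟩
  · simpa [Fin.val_inj] using hmn
  · rw [eq_top_iff, ← h.iSup_lowered_eq_top hgen]
    refine iSup_le fun n => ?_
    rcases le_or_gt n N with hn | hn
    · rw [← h.sector_eq_lowered hgen, hN]
      exact le_iSup (fun m : Fin (N + 1) => sector V (N - 2 * ((m : ℕ) : ℂ)))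
        ⟨n, Nat.lt_succ_of_le hn⟩
    · rw [h.lowered_eq_bot hgen hN hn]
      exact bot_le

theorem exists_mem_sector_of_ne_bot (h : HasHighestWeight Ω d) {W : LieSubmodule ℂ LSL2 V}
    (hW : W ≠ ⊥) : ∃ n : ℕ, 2 * n ≤ N ∧ ∃ v ∈ W, v ≠ 0 ∧ v ∈ sector V (N - 2 * n) := by
  obtain ⟨c, hc⟩ : ∃ c, W.toSubmodule ⊓ sector V c ≠ ⊥ := by
    by_contra! hbot
    have hinf : W.toSubmodule ⊓ ⨆ c, sector V c = ⨆ c, W.toSubmodule ⊓ sector V c :=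
      Submodule.inf_iSup_genEigenspace (fun x hx => W.lie_mem hx) 1
    rw [h.iSup_sector_eq_top hgen, inf_top_eq, iSup_eq_bot.2 hbot] at hinf
    exact hW ((LieSubmodule.toSubmodule_eq_bot W).1 hinf)
  obtain ⟨v, ⟨hvW, hv⟩, hv0⟩ := Submodule.exists_mem_ne_zero_of_ne_bot hc
  obtain ⟨n, rfl⟩ : ∃ n : ℕ, c = d 1 - 2 * n := by
    by_contra! hn
    exact hc (by rw [h.sector_eq_bot hgen hn, inf_bot_eq])
  obtain ⟨m, rfl⟩ : ∃ m, N = n + m := Nat.exists_eq_add_of_le <| by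
    by_contra! hn
    rw [h.sector_eq_lowered hgen, h.lowered_eq_bot hgen hN hn, inf_bot_eq] at hc
    exact hc rfl
  rw [hN] at hv
  rcases le_or_gt n m with hnm | hnm
  · exact ⟨n, by lia, v, hvW, hv0, hv⟩
  obtain ⟨k, rfl⟩ := Nat.exists_eq_add_of_lt hnm
  have hv' : v ∈ sector V (-((k + 1 : ℕ) : ℂ)) := by
    rw [show -((k + 1 : ℕ) : ℂ) = (m + k + 1 + m : ℕ) - 2 * (m + k + 1 : ℕ) by push_cast; ring]
    exact hv
  refine ⟨m, by lia, _, ?_, raise_pow_ne_zero hv' hv0, ?_⟩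
  · exact Module.End.pow_apply_mem_of_forall_mem (p := W.toSubmodule) _
      (fun x hx => W.lie_mem hx) v hvW
  · convert raise_pow_mem_sector hv' 1 (k + 1) using 2
    push_cast
    ring

end Generated

theorem isReducible {Ω' : V} {d' : ℂ[T;T⁻¹] →ₗ[ℂ] ℂ} (h : HasHighestWeight Ω d)
    (h' : HasHighestWeight Ω' d') (hd : ∀ n : ℕ, d 1 ≠ d' 1 - 2 * n) : IsReducible V := by
  refine ⟨LieSubmodule.lieSpan ℂ LSL2 {Ω'}, fun hbot => ?_, fun htop => ?_⟩
  · exact h'.ne_zero (by simpa [LieSubmodule.lieSpan_eq_bot_iff] using hbot)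
  · have hΩ := h.mem_sector
    rw [h'.sector_eq_bot htop hd, Submodule.mem_bot] at hΩ
    exact h.ne_zero hΩ

end HasHighestWeight

theorem finrank_sector_neg_le [FiniteDimensional ℂ V] (n : ℕ) :
    Module.finrank ℂ (sector V (-(n : ℂ))) ≤ Module.finrank ℂ (sector V (n : ℂ)) := by
  have hmaps : ∀ v ∈ sector V (-(n : ℂ)), (toEnd ℂ LSL2 V (raise 1) ^ n) v ∈ sector V (n : ℂ) :=
    fun v hv => by convert raise_pow_mem_sector hv 1 n using 2; ring
  refine LinearMap.finrank_le_finrank_of_injective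
    (f := (toEnd ℂ LSL2 V (raise 1) ^ n).restrict hmaps) ?_
  rw [← LinearMap.ker_eq_bot, Submodule.eq_bot_iff]
  intro v hv
  by_contra hv0
  exact raise_pow_ne_zero v.2 (by simpa using hv0) (congrArg Subtype.val hv)

end HighestWeight

section Garland

variable {V : Type*} [AddCommGroup V] [Module ℂ V] [LieRingModule LSL2 V] {Ω : V}
  {d : ℂ[T;T⁻¹] →ₗ[ℂ] ℂ}

theorem HasHighestWeight.raise_lower (h : HasHighestWeight Ω d) (q r : ℂ[T;T⁻¹]) :
    ⁅raise q, ⁅lower r, Ω⁆⁆ = d (q * r) • Ω := by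
  rw [raise_lower_lie, h.cartan_lie, h.raise_lie, lie_zero, add_zero]

theorem HasHighestWeight.eq_zero_of_lower_eq_zero (h : HasHighestWeight Ω d) {q : ℂ[T;T⁻¹]}
    (hq : ⁅lower q, Ω⁆ = 0) : d q = 0 := by
  have := h.raise_lower 1 q
  rw [hq, lie_zero, one_mul] at this
  exact (smul_eq_zero.1 this.symm).resolve_right h.ne_zero

variable [LieModule ℂ LSL2 V]

theorem toEnd_mul_toEnd_sub (x y : LSL2) :
    toEnd ℂ LSL2 V x * toEnd ℂ LSL2 V y - toEnd ℂ LSL2 V y * toEnd ℂ LSL2 V x =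
      toEnd ℂ LSL2 V ⁅x, y⁆ :=
  LinearMap.ext fun v => (lie_lie x y v).symm

theorem commute_toEnd_of_lie_eq_zero {x y : LSL2} (hxy : ⁅x, y⁆ = 0) :
    Commute (toEnd ℂ LSL2 V x) (toEnd ℂ LSL2 V y) :=
  sub_eq_zero.1 (by rw [toEnd_mul_toEnd_sub, hxy, map_zero])

theorem divPow_apply (x : LSL2) (n : ℕ) (v : V) :
    divPow V x n v = ((n.factorial : ℂ)⁻¹) • (toEnd ℂ LSL2 V x ^ n) v := rfl

theorem divPow_zero_apply (x : LSL2) (v : V) : divPow V x 0 v = v := by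
  simp [divPow_apply]

theorem divPow_one_apply (x : LSL2) (v : V) : divPow V x 1 v = ⁅x, v⁆ := by
  simp [divPow_apply]

theorem lie_divPow (x : LSL2) (n : ℕ) (v : V) :
    ⁅x, divPow V x n v⁆ = (n + 1 : ℂ) • divPow V x (n + 1) v := by
  rw [divPow_apply, divPow_apply, lie_smul, ← toEnd_apply_apply ℂ, ← Module.End.mul_apply,
    ← pow_succ', smul_smul, Nat.factorial_succ]
  push_cast
  rw [mul_inv, mul_inv_cancel_left₀ (Nat.cast_add_one_ne_zero n)]

namespace HasHighestWeight

theorem cartan_lower (h : HasHighestWeight Ω d) (q r : ℂ[T;T⁻¹]) :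
    ⁅cartan q, ⁅lower r, Ω⁆⁆ = d q • ⁅lower r, Ω⁆ - (2 : ℂ) • ⁅lower (q * r), Ω⁆ := by
  rw [cartan_lower_lie, h.cartan_lie, lie_smul]

theorem lower_mul_eq_zero (h : HasHighestWeight Ω d) {q : ℂ[T;T⁻¹]} (hq : ⁅lower q, Ω⁆ = 0)
    (r : ℂ[T;T⁻¹]) : ⁅lower (r * q), Ω⁆ = 0 := by
  simpa [hq] using h.cartan_lower r q

theorem lower_eq_zero_of_dvd (h : HasHighestWeight Ω d) {q r : ℂ[T;T⁻¹]} (hq : ⁅lower q, Ω⁆ = 0)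
    (hqr : q ∣ r) : ⁅lower r, Ω⁆ = 0 := by
  obtain ⟨s, rfl⟩ := hqr
  rw [mul_comm]
  exact h.lower_mul_eq_zero hq s

theorem two_smul_raise_pow_lower_pow (h : HasHighestWeight Ω d) (q r : ℂ[T;T⁻¹]) (n : ℕ) :
    (2 : ℂ) • (toEnd ℂ LSL2 V (raise q) ^ (n + 1)) ((toEnd ℂ LSL2 V (lower r) ^ (n + 2)) Ω) =
      (2 * (n + 2) : ℂ) • ⁅lower r,
        (toEnd ℂ LSL2 V (raise q) ^ (n + 1)) ((toEnd ℂ LSL2 V (lower r) ^ (n + 1)) Ω)⁆ +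
      ((n + 1) * (n + 2) : ℂ) • (⁅cartan (q * r),
        (toEnd ℂ LSL2 V (raise q) ^ n) ((toEnd ℂ LSL2 V (lower r) ^ (n + 1)) Ω)⁆ - d (q * r) •
        (toEnd ℂ LSL2 V (raise q) ^ n) ((toEnd ℂ LSL2 V (lower r) ^ (n + 1)) Ω)) := by
  set E := toEnd ℂ LSL2 V (raise q) with hE
  set F := toEnd ℂ LSL2 V (lower r) with hF
  set H := toEnd ℂ LSL2 V (cartan (q * r)) with hH
  have hEF : E * F - F * E = H := by rw [hE, hF, toEnd_mul_toEnd_sub, raise_lie_lower]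
  have hcommE : Commute E (H * E - E * H) := by
    rw [hH, hE, toEnd_mul_toEnd_sub, cartan_lie_raise, map_smul]
    exact (commute_toEnd_of_lie_eq_zero (raise_lie_raise _ _)).smul_right _
  have hcommF : Commute F (H * F - F * H) := by
    rw [hH, hF, toEnd_mul_toEnd_sub, cartan_lie_lower, map_smul]
    exact (commute_toEnd_of_lie_eq_zero (lower_lie_lower _ _)).smul_right _
  have hEΩ : E Ω = 0 := h.raise_lie q
  have hHΩ : H Ω = d (q * r) • Ω := h.cartan_lie _
  have hleft := congrArg (fun X : Module.End ℂ V => X ((F ^ (n + 1)) Ω))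
    (two_nsmul_pow_succ_mul_sub hEF hcommE n)
  have hright := congrArg (fun X : Module.End ℂ V => (E ^ n) (X Ω))
    (two_nsmul_mul_pow_succ_sub hEF hcommF (n + 1))
  simp only [LinearMap.smul_apply, LinearMap.sub_apply, LinearMap.add_apply, Module.End.mul_apply,
    hEΩ, hHΩ, map_zero, sub_zero, map_smul, map_add, ← Nat.cast_smul_eq_nsmul ℂ]
    at hleft hright
  rw [← Module.End.mul_apply, ← pow_succ] at hright
  rw [← Module.End.mul_apply F, ← pow_succ'] at hleft
  change _ = _ • F _ + _ • (H _ - _)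
  push_cast at hleft hright
  linear_combination (norm := module) (n + 2 : ℂ) • hleft - (n + 1 : ℂ) • hright

theorem two_smul_divPow_raise_divPow_lower (h : HasHighestWeight Ω d) (q r : ℂ[T;T⁻¹]) (n : ℕ) :
    (2 : ℂ) • divPow V (raise q) (n + 1) (divPow V (lower r) (n + 2) Ω) =
      (2 : ℂ) • ⁅lower r, divPow V (raise q) (n + 1) (divPow V (lower r) (n + 1) Ω)⁆ +
      (⁅cartan (q * r), divPow V (raise q) n (divPow V (lower r) (n + 1) Ω)⁆ -
        d (q * r) • divPow V (raise q) n (divPow V (lower r) (n + 1) Ω)) := by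
  have hn : (n.factorial : ℂ) ≠ 0 := Nat.cast_ne_zero.2 n.factorial_ne_zero
  have hn1 : (n + 1 : ℂ) ≠ 0 := Nat.cast_add_one_ne_zero n
  have hn2 : (n + 1 + 1 : ℂ) ≠ 0 := by exact_mod_cast (n + 1).succ_ne_zero
  simp only [divPow_apply, map_smul, lie_smul, Nat.factorial_succ]
  push_cast
  have key := h.two_smul_raise_pow_lower_pow q r n
  linear_combination (norm := (match_scalars <;> field_simp <;> ring))
    ((n + 1) * n.factorial * ((n + 1 + 1) * ((n + 1) * n.factorial)) : ℂ)⁻¹ • key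

-- Garland's identity: `p k` are the coefficients of the generating series of the scalars by which
-- the products `E⁽ᵏ⁾ F⁽ᵏ⁾` act on `Ω`.
theorem divPow_raise_divPow_lower_succ (h : HasHighestWeight Ω d) {q r : ℂ[T;T⁻¹]} {p : ℕ → ℂ}
    {n : ℕ} (hp : ∀ k ≤ n,
      divPow V (raise q) k (divPow V (lower r) k Ω) = ((-1) ^ k * p k : ℂ) • Ω) :
    divPow V (raise q) n (divPow V (lower r) (n + 1) Ω) = (-1 : ℂ) ^ n •
      ⁅lower (∑ ij ∈ antidiagonal n, p ij.1 • ((q * r) ^ ij.2 * r)), Ω⁆ := by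
  induction n with
  | zero =>
    have h0 := hp 0 le_rfl
    simp only [divPow_zero_apply, pow_zero, one_mul] at h0
    rw [divPow_zero_apply, Finset.Nat.antidiagonal_zero, Finset.sum_singleton, pow_zero, pow_zero,
      one_smul, one_mul, map_smul, smul_loop_lie, ← lie_smul, ← h0, divPow_one_apply]
  | succ n ih =>
    have ih := ih fun k hk => hp k (hk.trans n.le_succ)
    have step := h.two_smul_divPow_raise_divPow_lower q r n
    rw [ih, hp (n + 1) le_rfl, lie_smul, lie_smul, h.cartan_lower] at step
    refine (smul_right_inj (two_ne_zero' ℂ)).1 (step.trans ?_)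
    have hsum : ∑ ij ∈ antidiagonal n, p ij.1 • ((q * r) ^ (ij.2 + 1) * r) =
        q * r * ∑ ij ∈ antidiagonal n, p ij.1 • ((q * r) ^ ij.2 * r) := by
      rw [Finset.mul_sum]
      exact Finset.sum_congr rfl fun ij _ => by rw [pow_succ', mul_smul_comm, mul_assoc]
    rw [Finset.Nat.sum_antidiagonal_succ', hsum, pow_zero, one_mul, map_add, add_lie, map_smul,
      smul_loop_lie]
    module

end HasHighestWeight

end Garland

section LaurentFunctionals

theorem laurent_linearMap_ext {R M : Type*} [Semiring R] [AddCommMonoid M] [Module R M]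
    {d d' : R[T;T⁻¹] →ₗ[R] M} (h : ∀ k, d (T k) = d' (T k)) : d = d' :=
  (AddMonoidAlgebra.basis ℤ R).ext fun k => by
    rw [AddMonoidAlgebra.basis_apply]
    exact h k

-- The values `d (T k)` satisfy a linear recursion whose lowest coefficient is a unit, so that
-- vanishing propagates downwards.
theorem laurent_linearMap_eq_zero {R M : Type*} [CommRing R] [AddCommGroup M] [Module R M]
    {d : R[T;T⁻¹] →ₗ[R] M} {p : R[X]} (hp : IsUnit (p.coeff 0))
    (hdp : ∀ q, d (q * p.toLaurent) = 0) (hd : ∀ k : ℕ, d (T (k + 1)) = 0) : d = 0 := by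
  suffices h : ∀ m ≤ 1, ∀ k ≥ m, d (T k) = 0 from
    laurent_linearMap_ext fun k => h (min k 1) (min_le_right _ _) k (min_le_left _ _)
  intro m hm
  induction m, hm using Int.leInductionDown with
  | base =>
    intro k hk
    obtain ⟨n, rfl⟩ := Int.le.dest hk
    rw [add_comm]
    exact hd n
  | pred m _ ih =>
    intro k hk
    rcases hk.lt_or_eq with hk | rfl
    · exact ih k (by lia)
    have hterm (i : ℕ) : d (T (m - 1) * (Polynomial.C (p.coeff i) * Polynomial.X ^ i).toLaurent) =
        p.coeff i • d (T (m - 1 + i)) := by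
      rw [Polynomial.toLaurent_C_mul_X_pow, ← smul_eq_C_mul, mul_smul_comm, ← T_add, map_smul]
    have hsum := hdp (T (m - 1))
    rw [p.as_sum_range_C_mul_X_pow, map_sum, Finset.mul_sum, map_sum, Finset.sum_range_succ',
      Finset.sum_eq_zero fun i _ => by rw [hterm, ih _ (by lia), smul_zero], hterm, zero_add,
      Nat.cast_zero, add_zero] at hsum
    exact hp.smul_eq_zero.1 hsum

/-- The Laurent polynomial `t - b`. -/
def linearFactor {R : Type*} [CommRing R] (b : R) : R[T;T⁻¹] :=
  T 1 - C b

theorem toLaurent_prod_X_sub_C {R : Type*} [CommRing R] (A : Multiset R) :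
    (A.map fun a => Polynomial.X - Polynomial.C a).prod.toLaurent =
      (A.map linearFactor).prod := by
  rw [map_multiset_prod, Multiset.map_map]
  exact congrArg Multiset.prod (Multiset.map_congr rfl fun a _ => by simp [linearFactor])

section EvalAt

variable {R : Type*} [CommRing R]

/-- Evaluation of Laurent polynomials at a unit. -/
def evalAt (b : Rˣ) : R[T;T⁻¹] →ₐ[R] R :=
  { eval₂ (RingHom.id R) b with commutes' := fun c => eval₂_C _ _ c }

theorem evalAt_C (b : Rˣ) (c : R) : evalAt b (C c) = c :=
  (evalAt b).commutes c

theorem evalAt_T (b : Rˣ) (k : ℤ) : evalAt b (T k) = ↑(b ^ k) :=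
  eval₂_T _ _ k

theorem evalAt_toLaurent (b : Rˣ) (p : R[X]) : evalAt b p.toLaurent = p.eval (b : R) :=
  eval₂_toLaurent _ _ p

theorem evalAt_linearFactor (b : Rˣ) (c : R) : evalAt b (linearFactor c) = b - c := by
  rw [linearFactor, map_sub, evalAt_T, evalAt_C, zpow_one]

theorem linearFactor_dvd_of_evalAt_eq_zero {b : Rˣ} {p : R[T;T⁻¹]} (hp : evalAt b p = 0) :
    linearFactor (b : R) ∣ p := by
  obtain ⟨n, f, hf⟩ := exists_T_pow p
  have hroot : f.IsRoot b := by
    rw [Polynomial.IsRoot, ← evalAt_toLaurent, hf, map_mul, hp, zero_mul]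
  have hdvd := map_dvd (Polynomial.toLaurent (R := R)) (Polynomial.dvd_iff_isRoot.2 hroot)
  rwa [hf, (isUnit_T _).dvd_mul_right, map_sub, Polynomial.toLaurent_X, Polynomial.toLaurent_C]
    at hdvd

theorem linearFactor_mul_dvd_of_evalAt_eq_zero [IsDomain R] {a b : Rˣ} (hab : a ≠ b)
    {p : R[T;T⁻¹]} (ha : evalAt a p = 0) (hb : evalAt b p = 0) :
    linearFactor (a : R) * linearFactor (b : R) ∣ p := by
  obtain ⟨q, rfl⟩ := linearFactor_dvd_of_evalAt_eq_zero ha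
  rw [map_mul, evalAt_linearFactor, mul_eq_zero, sub_eq_zero, Units.val_inj] at hb
  exact mul_dvd_mul_left _ (linearFactor_dvd_of_evalAt_eq_zero (hb.resolve_left hab.symm))

/-- The linear functional `∑_{b ∈ B} ev_b` on Laurent polynomials; its value at `T k` is the
`k`-th power sum of the parameters `B`. -/
def powerSum (B : Multiset Rˣ) : R[T;T⁻¹] →ₗ[R] R :=
  (B.map fun b => (evalAt b).toLinearMap).sum

theorem powerSum_apply (B : Multiset Rˣ) (q : R[T;T⁻¹]) :
    powerSum B q = (B.map fun b => evalAt b q).sum := by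
  rw [powerSum, ← LinearMap.applyₗ_apply_apply (R := R), map_multiset_sum, Multiset.map_map]
  rfl

theorem powerSum_one (B : Multiset Rˣ) : powerSum B 1 = B.card := by
  simp [powerSum_apply]

theorem evalAt_eq_zero_of_powerSum_mul_eq_zero [IsDomain R] [CharZero R] {B : Multiset Rˣ}
    {p : R[T;T⁻¹]} (hp : ∀ q, powerSum B (q * p) = 0) {b : Rˣ} (hb : b ∈ B) :
    evalAt b p = 0 := by
  classical
  let q : R[T;T⁻¹] := ∏ c ∈ B.toFinset.erase b, linearFactor (c : R)
  have hq (c : Rˣ) : evalAt c q = ∏ c' ∈ B.toFinset.erase b, ((c : R) - c') := by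
    simp_rw [q, map_prod, evalAt_linearFactor]
  have hqb : evalAt b q ≠ 0 := by
    rw [hq, Finset.prod_ne_zero_iff]
    intro c hc h
    exact Finset.ne_of_mem_erase hc (Units.ext (sub_eq_zero.1 h)).symm
  have hsum := hp q
  rw [powerSum_apply, Finset.sum_multiset_map_count, Finset.sum_eq_single b, map_mul,
    nsmul_eq_mul, mul_eq_zero, mul_eq_zero, Nat.cast_eq_zero] at hsum
  · exact (hsum.resolve_left (Multiset.count_ne_zero.2 hb)).resolve_left hqb
  · intro c hc hcb
    rw [map_mul, hq, Finset.prod_eq_zero (Finset.mem_erase.2 ⟨hcb, hc⟩) (sub_self _), zero_mul,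
      smul_zero]
  · exact fun h => absurd (Multiset.mem_toFinset.2 hb) h

end EvalAt

/-- The Drinfeld polynomial `∏_{a ∈ A} (1 - a X)` of a multiset of parameters. -/
def drinfeldPoly {R : Type*} [CommRing R] (A : Multiset R) : R[X] :=
  (A.map fun a => 1 - Polynomial.C a * Polynomial.X).prod

theorem drinfeldPoly_cons {R : Type*} [CommRing R] (a : R) (A : Multiset R) :
    drinfeldPoly (a ::ₘ A) = (1 - Polynomial.C a * Polynomial.X) * drinfeldPoly A := by
  rw [drinfeldPoly, Multiset.map_cons, Multiset.prod_cons, drinfeldPoly]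

theorem derivative_drinfeldPoly {R : Type*} [CommRing R] (A : Multiset R) :
    PowerSeries.derivative R (drinfeldPoly A : PowerSeries R) =
      -((drinfeldPoly A : PowerSeries R) * PowerSeries.mk fun k => (A.map (· ^ (k + 1))).sum) := by
  induction A using Multiset.induction_on with
  | empty =>
    rw [drinfeldPoly, Multiset.map_zero, Multiset.prod_zero, Polynomial.coe_one,
      Derivation.map_one_eq_zero]
    ext
    simp
  | cons a A ih =>
    have hgeom : (1 - PowerSeries.C a * PowerSeries.X) * PowerSeries.mk (fun k => a ^ (k + 1)) =
        PowerSeries.C a := by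
      ext (_ | k) <;>
      simp [sub_mul, mul_assoc, PowerSeries.coeff_succ_X_mul, pow_succ', PowerSeries.coeff_C]
    have hadd : PowerSeries.mk (fun k => ((a ::ₘ A).map (· ^ (k + 1))).sum) =
        PowerSeries.mk (fun k => a ^ (k + 1)) +
          PowerSeries.mk fun k => (A.map (· ^ (k + 1))).sum := by
      ext
      simp
    have ha : PowerSeries.derivative R (1 - PowerSeries.C a * PowerSeries.X) =
        -PowerSeries.C a := by
      rw [map_sub, Derivation.map_one_eq_zero, Derivation.leibniz, PowerSeries.derivative_X,
        PowerSeries.derivative_C]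
      simp
    rw [drinfeldPoly_cons, Polynomial.coe_mul, Polynomial.coe_sub, Polynomial.coe_one,
      Polynomial.coe_mul, Polynomial.coe_C, Polynomial.coe_X, Derivation.leibniz, ha, ih, hadd,
      smul_eq_mul, smul_eq_mul]
    linear_combination (drinfeldPoly A : PowerSeries R) * hgeom

theorem aeval_T_neg_one_mul_T {R : Type*} [CommSemiring R] {p : R[X]} {n : ℕ}
    (hp : p.natDegree ≤ n) :
    Polynomial.aeval (T (-1) : R[T;T⁻¹]) p * T n =
      ∑ ij ∈ antidiagonal n, p.coeff ij.1 • (T 1 : R[T;T⁻¹]) ^ ij.2 := by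
  rw [Polynomial.aeval_eq_sum_range' (Nat.lt_succ_of_le hp), Finset.sum_mul,
    Finset.Nat.sum_antidiagonal_eq_sum_range_succ_mk]
  refine Finset.sum_congr rfl fun i hi => ?_
  have hin : i ≤ n := Finset.mem_range_succ_iff.1 hi
  rw [smul_mul_assoc, T_pow, T_pow, ← T_add]
  congr 2
  push_cast [hin]
  ring

theorem natDegree_drinfeldPoly_le {R : Type*} [CommRing R] (A : Multiset R) :
    (drinfeldPoly A).natDegree ≤ A.card := by
  refine (Polynomial.natDegree_multiset_prod_le _).trans ?_
  rw [Multiset.map_map]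
  refine (Multiset.sum_le_card_nsmul _ 1 ?_).trans (by simp)
  simp only [Multiset.mem_map, Function.comp_apply, forall_exists_index, and_imp,
    forall_apply_eq_imp_iff₂]
  intro a _
  compute_degree

theorem coeff_zero_drinfeldPoly {R : Type*} [CommRing R] (A : Multiset R) :
    (drinfeldPoly A).coeff 0 = 1 := by
  simp [drinfeldPoly, Polynomial.coeff_zero_multiset_prod]

theorem sum_antidiagonal_coeff_drinfeldPoly {R : Type*} [CommRing R] (A : Multiset R) :
    ∑ ij ∈ antidiagonal A.card, (drinfeldPoly A).coeff ij.1 • (T 1 : R[T;T⁻¹]) ^ ij.2 =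
      (A.map linearFactor).prod := by
  have hT : (T A.card : R[T;T⁻¹]) = (A.map fun _ => T 1).prod := by simp [T_pow]
  rw [← aeval_T_neg_one_mul_T (natDegree_drinfeldPoly_le A), drinfeldPoly, map_multiset_prod,
    Multiset.map_map, hT, ← Multiset.prod_map_mul]
  congr 1
  refine Multiset.map_congr rfl fun a _ => ?_
  rw [Function.comp_apply, map_sub, map_one, map_mul, Polynomial.aeval_C, Polynomial.aeval_X,
    sub_mul, one_mul, mul_assoc, ← T_add, linearFactor, LaurentPolynomial.C_eq_algebraMap]
  simp

end LaurentFunctionals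

section Parameters

variable {V : Type*} [AddCommGroup V] [Module ℂ V] [LieRingModule LSL2 V] [LieModule ℂ LSL2 V]
  {Ω : V} {d : ℂ[T;T⁻¹] →ₗ[ℂ] ℂ} {A : Multiset ℂ}

theorem withParams_xm (A : Multiset ℂ) : withParams xm A = lower (A.map linearFactor).prod := by
  rw [← toLaurent_prod_X_sub_C, Multiset.prod_X_sub_X_eq_sum_esymm, map_sum, map_sum]
  refine Finset.sum_congr rfl fun k hk => ?_
  have hk : k ≤ A.card := Finset.mem_range_succ_iff.1 hk
  rw [xm_eq_lower, ← map_smul, smul_eq_C_mul]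
  simp [Nat.cast_sub hk, mul_assoc]

theorem HasEvaluationParameters.divPow_raise_divPow_lower (hA : HasEvaluationParameters Ω A)
    {k : ℕ} (hk : k ≤ A.card) : divPow V (raise 1) k (divPow V (lower (T 1)) k Ω) =
      ((-1) ^ k * (drinfeldPoly A).coeff k : ℂ) • Ω := by
  obtain ⟨-, l, hl, hsum⟩ := hA
  have hcoeff : (drinfeldPoly A).coeff k = l k * (-1) ^ k := by
    have hterm (i : ℕ) : Polynomial.C (l i) * (-Polynomial.X) ^ i =
        Polynomial.C (l i * (-1) ^ i) * Polynomial.X ^ i := by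
      simp [neg_pow (Polynomial.X : ℂ[X]), mul_assoc]
    simp_rw [hterm] at hsum
    rw [drinfeldPoly, ← hsum, Polynomial.finsetSum_coeff]
    simp only [Polynomial.coeff_C_mul_X_pow, Finset.sum_ite_eq, Finset.mem_range,
      Nat.lt_succ_of_le hk, if_true]
  refine (hl k hk).trans ?_
  rw [hcoeff, mul_left_comm, ← mul_pow, neg_one_mul, neg_neg, one_pow, mul_one]

theorem HasEvaluationParameters.weight_one (hA : HasEvaluationParameters Ω A)
    (h : HasHighestWeight Ω d) : d 1 = A.card :=
  smul_left_injective ℂ h.ne_zero ((h.cartan_lie 1).symm.trans hA.1)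

theorem lower_pow_mem_lowered (q : ℂ[T;T⁻¹]) (n : ℕ) :
    (toEnd ℂ LSL2 V (lower q) ^ n) Ω ∈ lowered Ω n := by
  induction n with
  | zero => exact self_mem_lowered
  | succ n ih =>
    rw [pow_succ', Module.End.mul_apply]
    exact lower_mem_lowered ih q

namespace HasHighestWeight

theorem lower_pow_ne_zero (h : HasHighestWeight Ω d) {N : ℕ} (hN : d 1 = N) {q : ℂ[T;T⁻¹]}
    (hq : IsUnit q) : (toEnd ℂ LSL2 V (lower q) ^ N) Ω ≠ 0 := by
  obtain ⟨r, hr⟩ := hq.exists_left_inv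
  have P : (isSl2Triple hr).HasPrimitiveVectorWith Ω (N : ℂ) :=
    ⟨h.ne_zero, hN ▸ h.cartan_lie 1, h.raise_lie r⟩
  exact P.pow_toEnd_f_ne_zero_of_eq_nat rfl le_rfl

variable [FiniteDimensional ℂ V]

theorem zero_notMem_parameters (h : HasHighestWeight Ω d) (hA : HasEvaluationParameters Ω A) :
    0 ∉ A := by
  intro h0
  have hcoeff : (drinfeldPoly A).coeff A.card = 0 := by
    obtain ⟨A, rfl⟩ := Multiset.exists_cons_of_mem h0
    rw [drinfeldPoly_cons, Polynomial.C_0, zero_mul, sub_zero, one_mul, Multiset.card_cons]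
    exact Polynomial.coeff_eq_zero_of_natDegree_lt
      (Nat.lt_succ_of_le (natDegree_drinfeldPoly_le A))
  have hmem : (toEnd ℂ LSL2 V (lower (T 1)) ^ A.card) Ω ∈ sector V (-(A.card : ℂ)) := by
    convert lowered_le_sector h.mem_sector _ (lower_pow_mem_lowered _ _) using 2
    rw [hA.weight_one h]
    ring
  have hzero := hA.divPow_raise_divPow_lower le_rfl
  rw [hcoeff, mul_zero, zero_smul, divPow_apply, divPow_apply, map_smul] at hzero
  simp only [smul_eq_zero, inv_eq_zero, Nat.cast_eq_zero, Nat.factorial_ne_zero, false_or] at hzero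
  exact raise_pow_ne_zero hmem (h.lower_pow_ne_zero (hA.weight_one h) (isUnit_T 1)) hzero

variable (hgen : LieSubmodule.lieSpan ℂ LSL2 {Ω} = (⊤ : LieSubmodule ℂ LSL2 V))

include hgen

theorem divPow_lower_eq_zero (h : HasHighestWeight Ω d) {N : ℕ} (hN : d 1 = N) (q : ℂ[T;T⁻¹])
    {n : ℕ} (hn : N < n) : divPow V (lower q) n Ω = 0 := by
  have hmem := lower_pow_mem_lowered (Ω := Ω) q n
  rw [h.lowered_eq_bot hgen hN hn, Submodule.mem_bot] at hmem
  rw [divPow_apply, hmem, smul_zero]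

theorem divPow_raise_divPow_lower_self (h : HasHighestWeight Ω d)
    (hA : HasEvaluationParameters Ω A) (k : ℕ) :
    divPow V (raise 1) k (divPow V (lower (T 1)) k Ω) =
      ((-1) ^ k * (drinfeldPoly A).coeff k : ℂ) • Ω := by
  rcases le_or_gt k A.card with hk | hk
  · exact hA.divPow_raise_divPow_lower hk
  · rw [h.divPow_lower_eq_zero hgen (hA.weight_one h) _ hk, map_zero,
      Polynomial.coeff_eq_zero_of_natDegree_lt ((natDegree_drinfeldPoly_le A).trans_lt hk),
      mul_zero, zero_smul]

theorem divPow_raise_divPow_lower (h : HasHighestWeight Ω d) (hA : HasEvaluationParameters Ω A)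
    (n : ℕ) : divPow V (raise 1) n (divPow V (lower (T 1)) (n + 1) Ω) = (-1 : ℂ) ^ n •
      ⁅lower (∑ ij ∈ antidiagonal n, (drinfeldPoly A).coeff ij.1 • T 1 ^ (ij.2 + 1)), Ω⁆ := by
  rw [h.divPow_raise_divPow_lower_succ fun k _ => h.divPow_raise_divPow_lower_self hgen hA k]
  simp_rw [one_mul, ← pow_succ]

theorem drinfeldPoly_mul_mk_weight (h : HasHighestWeight Ω d) (hA : HasEvaluationParameters Ω A) :
    (drinfeldPoly A : PowerSeries ℂ) * PowerSeries.mk (fun k => d (T (k + 1))) =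
      -PowerSeries.derivative ℂ (drinfeldPoly A : PowerSeries ℂ) := by
  ext n
  have hraise := congrArg (⁅raise 1, ·⁆) (h.divPow_raise_divPow_lower hgen hA n)
  simp only [lie_divPow, h.divPow_raise_divPow_lower_self hgen hA, lie_smul, h.raise_lower,
    one_mul, smul_smul] at hraise
  replace hraise := smul_left_injective ℂ h.ne_zero hraise
  simp only [map_sum, map_smul, smul_eq_mul, T_pow, mul_one] at hraise
  rw [PowerSeries.coeff_mul, map_neg, PowerSeries.coeff_derivative]
  simp only [Polynomial.coeff_coe, PowerSeries.coeff_mk]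
  push_cast at hraise
  refine mul_left_cancel₀ (pow_ne_zero n (neg_ne_zero.2 (one_ne_zero' ℂ))) ?_
  rw [← hraise]
  ring

theorem weight_T_succ (h : HasHighestWeight Ω d) (hA : HasEvaluationParameters Ω A) (k : ℕ) :
    d (T (k + 1)) = (A.map (· ^ (k + 1))).sum := by
  have hne : (drinfeldPoly A : PowerSeries ℂ) ≠ 0 := by
    intro h0
    have hcoeff := congrArg (PowerSeries.coeff 0) h0
    rw [Polynomial.coeff_coe, coeff_zero_drinfeldPoly, map_zero] at hcoeff
    exact one_ne_zero hcoeff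
  have hmk := mul_left_cancel₀ hne ((h.drinfeldPoly_mul_mk_weight hgen hA).trans
    (by rw [derivative_drinfeldPoly, neg_neg]))
  simpa only [PowerSeries.coeff_mk] using congrArg (PowerSeries.coeff k) hmk

theorem lower_prod_parameters (h : HasHighestWeight Ω d) (hA : HasEvaluationParameters Ω A) :
    ⁅lower (A.map linearFactor).prod, Ω⁆ = 0 := by
  have hT : ⁅lower (T 1 * (A.map linearFactor).prod), Ω⁆ = 0 := by
    have hgarland := h.divPow_raise_divPow_lower hgen hA A.card
    rw [h.divPow_lower_eq_zero hgen (hA.weight_one h) _ A.card.lt_succ_self, map_zero] at hgarland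
    rw [← sum_antidiagonal_coeff_drinfeldPoly, Finset.mul_sum]
    simp_rw [mul_smul_comm, ← pow_succ']
    exact (smul_eq_zero.1 hgarland.symm).resolve_left (pow_ne_zero _ (neg_ne_zero.2 one_ne_zero))
  simpa [← mul_assoc, ← T_add] using h.lower_mul_eq_zero hT (T (-1))

-- Garland's identity only reaches `T k` with `k > 0`; the other values of `d` follow because `d`
-- and the power sums satisfy the same recursion, with characteristic polynomial
-- `∏_{b ∈ B} (X - b)`.
theorem weight_eq_powerSum {B : Multiset ℂˣ} (h : HasHighestWeight Ω d)
    (hB : HasEvaluationParameters Ω (B.map Units.val)) : d = powerSum B := by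
  let p : ℂ[X] := ((B.map Units.val).map fun b => Polynomial.X - Polynomial.C b).prod
  have hp : p.toLaurent = ((B.map Units.val).map linearFactor).prod := toLaurent_prod_X_sub_C _
  have hp0 : IsUnit (p.coeff 0) := by
    rw [Polynomial.coeff_zero_multiset_prod, Multiset.map_map, Multiset.map_map]
    refine IsUnit.mk0 _ (Multiset.prod_ne_zero ?_)
    simp
  have hpB (b) (hb : b ∈ B) : evalAt b p.toLaurent = 0 := by
    rw [hp, Multiset.map_map, map_multiset_prod, Multiset.map_map]
    refine Multiset.prod_eq_zero (Multiset.mem_map.2 ⟨b, hb, ?_⟩)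
    exact (evalAt_linearFactor b b).trans (sub_self _)
  refine sub_eq_zero.1 (laurent_linearMap_eq_zero hp0 (fun q => ?_) fun k => ?_)
  · have hd : d (q * p.toLaurent) = 0 := h.eq_zero_of_lower_eq_zero
      (h.lower_mul_eq_zero (hp ▸ h.lower_prod_parameters hgen hB) q)
    rw [LinearMap.sub_apply, hd, powerSum_apply, zero_sub, neg_eq_zero]
    refine Multiset.sum_eq_zero fun x hx => ?_
    obtain ⟨b, hb, rfl⟩ := Multiset.mem_map.1 hx
    rw [map_mul, hpB b hb, mul_zero]
  · rw [LinearMap.sub_apply, h.weight_T_succ hgen hB, powerSum_apply, Multiset.map_map]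
    simp_rw [evalAt_T]
    exact sub_eq_zero.2 (congrArg (fun f => (B.map f).sum) (funext fun b => by norm_cast))

end HasHighestWeight

end Parameters

section WeylRelations

variable {V : Type*} [AddCommGroup V] [Module ℂ V] [LieRingModule LSL2 V] [LieModule ℂ LSL2 V]
  {Ω : V}

namespace HasHighestWeight

theorem raise_lower_lower {d : ℂ[T;T⁻¹] →ₗ[ℂ] ℂ} (h : HasHighestWeight Ω d)
    (s q r : ℂ[T;T⁻¹]) : ⁅raise s, ⁅lower q, ⁅lower r, Ω⁆⁆⁆ =
      ⁅lower (d (s * q) • r + d (s * r) • q - (2 : ℂ) • (s * q * r)), Ω⁆ := by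
  rw [raise_lower_lie, h.cartan_lower, h.raise_lower, lie_smul]
  simp only [map_add, map_sub, map_smul, add_lie, sub_lie, smul_loop_lie]
  abel

theorem raise_lower_lower_lower {d : ℂ[T;T⁻¹] →ₗ[ℂ] ℂ} (h : HasHighestWeight Ω d)
    (s q r t : ℂ[T;T⁻¹]) : ⁅raise s, ⁅lower q, ⁅lower r, ⁅lower t, Ω⁆⁆⁆⁆ =
      d (s * q) • ⁅lower r, ⁅lower t, Ω⁆⁆ + d (s * r) • ⁅lower q, ⁅lower t, Ω⁆⁆ +
        d (s * t) • ⁅lower q, ⁅lower r, Ω⁆⁆ - (2 : ℂ) • (⁅lower t, ⁅lower (s * q * r), Ω⁆⁆ +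
          ⁅lower r, ⁅lower (s * q * t), Ω⁆⁆ + ⁅lower q, ⁅lower (s * r * t), Ω⁆⁆) := by
  rw [raise_lower_lie, h.raise_lower_lower, cartan_lower_lie, h.cartan_lower,
    lower_lower_lie_comm (s * q * r)]
  simp only [map_add, map_sub, map_smul, add_lie, sub_lie, smul_loop_lie, lie_add, lie_sub,
    lie_smul]
  module

omit [LieModule ℂ LSL2 V] in
theorem evalAt_eq_zero_of_raise_lower_eq_zero {B : Multiset ℂˣ}
    (h : HasHighestWeight Ω (powerSum B)) {p : ℂ[T;T⁻¹]}
    (hp : ∀ q, ⁅raise q, ⁅lower p, Ω⁆⁆ = 0) {b : ℂˣ} (hb : b ∈ B) : evalAt b p = 0 :=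
  evalAt_eq_zero_of_powerSum_mul_eq_zero
    (fun q => (smul_eq_zero.1 ((h.raise_lower q p).symm.trans (hp q))).resolve_right h.ne_zero) hb

end HasHighestWeight

/-- `Ω` satisfies the relations of the highest weight vector of the Weyl module with parameters
`B`: its weight consists of the power sums of `B`, and `∏_{b ∈ B} (t - b) ⊗ f` kills it. -/
structure HasWeylRelations (Ω : V) (B : Multiset ℂˣ) : Prop
    extends HasHighestWeight Ω (powerSum B) where
  lower_prod : ⁅lower ((B.map Units.val).map linearFactor).prod, Ω⁆ = 0

theorem HasHighestWeight.hasWeylRelations [FiniteDimensional ℂ V] {d : ℂ[T;T⁻¹] →ₗ[ℂ] ℂ}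
    {B : Multiset ℂˣ} (h : HasHighestWeight Ω d)
    (hgen : LieSubmodule.lieSpan ℂ LSL2 {Ω} = (⊤ : LieSubmodule ℂ LSL2 V))
    (hB : HasEvaluationParameters Ω (B.map Units.val)) : HasWeylRelations Ω B where
  toHasHighestWeight := h.weight_eq_powerSum hgen hB ▸ h
  lower_prod := h.lower_prod_parameters hgen hB

end WeylRelations

section Bases

theorem linearIndependent_triple {K V : Type*} [Ring K] [AddCommGroup V] [Module K V] {u v w : V}
    (h : ∀ x y z : K, x • u + y • v + z • w = 0 → x = 0 ∧ y = 0 ∧ z = 0) :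
    LinearIndependent K ![u, v, w] := by
  rw [Fintype.linearIndependent_iff]
  intro g hg
  obtain ⟨h0, h1, h2⟩ := h (g 0) (g 1) (g 2) (by simpa [Fin.sum_univ_three] using hg)
  exact Fin.forall_fin_succ.2 ⟨h0, Fin.forall_fin_two.2 ⟨h1, h2⟩⟩

theorem IsBasisOf.finrank_eq {V ι : Type*} [AddCommGroup V] [Module ℂ V] [Fintype ι] {b : ι → V}
    {W : Submodule ℂ V} (h : IsBasisOf b W) : Module.finrank ℂ W = Fintype.card ι := by
  rw [← h.2, finrank_span_eq_card h.1]

variable {V : Type*} [AddCommGroup V] [Module ℂ V] [LieRingModule LSL2 V] [LieModule ℂ LSL2 V]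
  [FiniteDimensional ℂ V]

theorem IsBasisOf.sector_neg {ι : Type*} [Finite ι] {n : ℕ} {b c : ι → V}
    (hb : IsBasisOf b (sector V n)) (hc : LinearIndependent ℂ c)
    (hmem : ∀ i, c i ∈ sector V (-(n : ℂ))) : IsBasisOf c (sector V (-(n : ℂ))) := by
  have := Fintype.ofFinite ι
  refine ⟨hc, Submodule.eq_of_le_of_finrank_le ?_ ?_⟩
  · exact Submodule.span_le.2 (Set.range_subset_iff.2 hmem)
  · rw [finrank_span_eq_card hc, ← hb.finrank_eq]
    exact finrank_sector_neg_le n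

end Bases

section DoubleParameter

variable {V : Type*} [AddCommGroup V] [Module ℂ V] [LieRingModule LSL2 V] [LieModule ℂ LSL2 V]
  {Ω : V} {a b : ℂˣ}

theorem powerSum_double_single (a b : ℂˣ) (q : ℂ[T;T⁻¹]) :
    powerSum {a, a, b} q = 2 * evalAt a q + evalAt b q := by
  simp [powerSum_apply, two_mul, add_assoc]

namespace HasWeylRelations

theorem mem_sector_three (h : HasWeylRelations Ω {a, a, b}) : Ω ∈ sector V 3 := by
  simpa [powerSum_one] using h.mem_sector

theorem lower_mem_sector_one (h : HasWeylRelations Ω {a, a, b}) (p : ℂ[T;T⁻¹]) :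
    ⁅lower p, Ω⁆ ∈ sector V 1 := by
  have := lower_mem_sector h.mem_sector_three p
  norm_num at this
  exact this

theorem lower_lower_mem_sector_neg_one (h : HasWeylRelations Ω {a, a, b}) (p q : ℂ[T;T⁻¹]) :
    ⁅lower p, ⁅lower q, Ω⁆⁆ ∈ sector V (-1) := by
  have := lower_mem_sector (h.lower_mem_sector_one q) p
  norm_num at this
  exact this

theorem lower_lower_lower_mem_sector_neg_three (h : HasWeylRelations Ω {a, a, b})
    (p q r : ℂ[T;T⁻¹]) : ⁅lower p, ⁅lower q, ⁅lower r, Ω⁆⁆⁆ ∈ sector V (-3) := by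
  have := lower_mem_sector (h.lower_lower_mem_sector_neg_one q r) p
  norm_num at this
  exact this

omit [LieModule ℂ LSL2 V] in
theorem lower_double_single (h : HasWeylRelations Ω {a, a, b}) :
    ⁅lower (linearFactor (a : ℂ) * (linearFactor (a : ℂ) * linearFactor (b : ℂ))), Ω⁆ = 0 := by
  simpa using h.lower_prod

theorem lower_mul_pair (h : HasWeylRelations Ω {a, a, b}) (q : ℂ[T;T⁻¹]) :
    ⁅lower (q * (linearFactor (a : ℂ) * linearFactor (b : ℂ))), Ω⁆ =
      evalAt a q • ⁅lower (linearFactor (a : ℂ) * linearFactor (b : ℂ)), Ω⁆ := by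
  obtain ⟨r, hr⟩ := linearFactor_dvd_of_evalAt_eq_zero (b := a) (p := q - C (evalAt a q))
    (by rw [map_sub, evalAt_C, sub_self])
  have hq : q * (linearFactor (a : ℂ) * linearFactor (b : ℂ)) =
      r * (linearFactor (a : ℂ) * (linearFactor (a : ℂ) * linearFactor (b : ℂ))) +
        evalAt a q • (linearFactor (a : ℂ) * linearFactor (b : ℂ)) := by
    rw [smul_eq_C_mul]
    linear_combination linearFactor (a : ℂ) * linearFactor (b : ℂ) * hr
  rw [hq, map_add, add_lie, h.lower_mul_eq_zero h.lower_double_single, zero_add, map_smul,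
    smul_loop_lie]

theorem hasHighestWeight_lower_pair (h : HasWeylRelations Ω {a, a, b})
    (hw : ⁅lower (linearFactor (a : ℂ) * linearFactor (b : ℂ)), Ω⁆ ≠ 0) :
    HasHighestWeight ⁅lower (linearFactor (a : ℂ) * linearFactor (b : ℂ)), Ω⁆ (powerSum {b}) where
  ne_zero := hw
  raise_lie q := by
    rw [h.raise_lower, powerSum_double_single]
    simp [evalAt_linearFactor]
  cartan_lie q := by
    rw [h.cartan_lower, h.lower_mul_pair, powerSum_double_single, powerSum_apply,
      Multiset.map_singleton, Multiset.sum_singleton]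
    module

theorem exists_lower_eq (h : HasWeylRelations Ω {a, a, b}) (hab : a ≠ b) (p : ℂ[T;T⁻¹]) :
    ∃ x y z : ℂ, x • ⁅lower (linearFactor (b : ℂ)), Ω⁆ + y • ⁅lower (linearFactor (a : ℂ)), Ω⁆ +
      z • ⁅lower (linearFactor (a : ℂ) * linearFactor (b : ℂ)), Ω⁆ = ⁅lower p, Ω⁆ := by
  have hδ : (a - b : ℂ) ≠ 0 := sub_ne_zero.2 (Units.val_injective.ne hab)
  let x : ℂ := evalAt a p / (a - b)
  let y : ℂ := evalAt b p / (b - a)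
  let remainder : ℂ[T;T⁻¹] := p - (x • linearFactor (b : ℂ) + y • linearFactor (a : ℂ))
  obtain ⟨q, hq⟩ := linearFactor_mul_dvd_of_evalAt_eq_zero hab (p := remainder)
    (by simp [remainder, x, evalAt_linearFactor, hδ])
    (by simp [remainder, y, evalAt_linearFactor, sub_ne_zero.2 (Units.val_injective.ne hab.symm)])
  refine ⟨x, y, evalAt a q, ?_⟩
  rw [← h.lower_mul_pair, mul_comm, ← hq]
  simp only [remainder, map_sub, map_add, map_smul, sub_lie, add_lie, smul_loop_lie]
  abel

theorem coeff_eq_zero_of_sector_one (h : HasWeylRelations Ω {a, a, b}) (hab : a ≠ b) {x y z : ℂ}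
    (h0 : x • ⁅lower (linearFactor (b : ℂ)), Ω⁆ + y • ⁅lower (linearFactor (a : ℂ)), Ω⁆ +
      z • ⁅lower (linearFactor (a : ℂ) * linearFactor (b : ℂ)), Ω⁆ = 0) : x = 0 ∧ y = 0 := by
  have hδ : (a - b : ℂ) ≠ 0 := sub_ne_zero.2 (Units.val_injective.ne hab)
  simp only [← smul_loop_lie, ← map_smul, ← add_lie, ← map_add] at h0
  have heval {c : ℂˣ} (hc : c ∈ ({a, a, b} : Multiset ℂˣ)) :=
    h.evalAt_eq_zero_of_raise_lower_eq_zero (fun q => by rw [h0, lie_zero]) hc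
  constructor
  · simpa [evalAt_linearFactor, hδ] using heval (c := a) (by simp)
  · simpa [evalAt_linearFactor, sub_ne_zero.2 (Units.val_injective.ne hab.symm)] using
      heval (c := b) (by simp)

theorem coeff_eq_zero_of_sector_neg_one (h : HasWeylRelations Ω {a, a, b}) (hab : a ≠ b)
    {x y z : ℂ} (h0 : x • ⁅lower (linearFactor (b : ℂ)), ⁅lower (linearFactor (b : ℂ)), Ω⁆⁆ +
      y • ⁅lower (linearFactor (b : ℂ)), ⁅lower (linearFactor (a : ℂ)), Ω⁆⁆ +
      z • ⁅lower (linearFactor (a : ℂ)),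
        ⁅lower (linearFactor (a : ℂ) * linearFactor (b : ℂ)), Ω⁆⁆ = 0) : x = 0 ∧ y = 0 := by
  have hδ : (a - b : ℂ) ≠ 0 := sub_ne_zero.2 (Units.val_injective.ne hab)
  have hraise := congrArg (⁅raise 1, ·⁆) h0
  simp only [lie_add, lie_smul, lie_zero, h.raise_lower_lower, one_mul] at hraise
  simp only [← smul_loop_lie, ← map_smul, ← add_lie, ← map_add] at hraise
  have heval {c : ℂˣ} (hc : c ∈ ({a, a, b} : Multiset ℂˣ)) :=
    h.evalAt_eq_zero_of_raise_lower_eq_zero (fun q => by rw [hraise, lie_zero]) hc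
  have ha := heval (c := a) (by simp)
  have hb := heval (c := b) (by simp)
  simp only [powerSum_double_single, map_add, map_sub, map_smul, map_mul, evalAt_linearFactor,
    smul_eq_mul, sub_self] at ha hb
  have hy : y = 0 := by
    have : (a - b : ℂ) ^ 2 * y = 0 := by linear_combination -hb / 2
    exact (mul_eq_zero.1 this).resolve_left (pow_ne_zero 2 hδ)
  have hx : (a - b : ℂ) ^ 2 * x = 0 := by
    rw [hy] at ha
    linear_combination ha / 2
  exact ⟨(mul_eq_zero.1 hx).resolve_left (pow_ne_zero 2 hδ), hy⟩

theorem lower_lower_lower_ne_zero (h : HasWeylRelations Ω {a, a, b}) (hab : a ≠ b) :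
    ⁅lower (linearFactor (b : ℂ)),
      ⁅lower (linearFactor (b : ℂ)), ⁅lower (linearFactor (a : ℂ)), Ω⁆⁆⁆ ≠ 0 := by
  intro h0
  have hδ : (a - b : ℂ) ≠ 0 := sub_ne_zero.2 (Units.val_injective.ne hab)
  have hABB : ⁅lower (linearFactor (a : ℂ) * linearFactor (b : ℂ) * linearFactor (b : ℂ)), Ω⁆ =
      (a - b : ℂ) • ⁅lower (linearFactor (a : ℂ) * linearFactor (b : ℂ)), Ω⁆ := by
    rw [mul_comm, h.lower_mul_pair, evalAt_linearFactor]
  have hABA : ⁅lower (linearFactor (a : ℂ) * linearFactor (b : ℂ) * linearFactor (a : ℂ)), Ω⁆ =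
      0 := by
    rw [mul_comm, h.lower_double_single]
  have hraise := congrArg (⁅raise (linearFactor (a : ℂ)), ·⁆) h0
  simp only [h.raise_lower_lower_lower, hABB, hABA, powerSum_double_single, map_mul,
    evalAt_linearFactor, lie_smul, lie_zero] at hraise
  have hx := (h.coeff_eq_zero_of_sector_neg_one hab (x := (a - b) ^ 2) (y := 0)
    (z := -2 * (a - b)) (hraise ▸ by module)).1
  exact pow_ne_zero 2 hδ hx

variable (hgen : LieSubmodule.lieSpan ℂ LSL2 {Ω} = (⊤ : LieSubmodule ℂ LSL2 V))

include hgen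

theorem mem_sector_one_iff (h : HasWeylRelations Ω {a, a, b}) {v : V} :
    v ∈ sector V 1 ↔ ∃ p, ⁅lower p, Ω⁆ = v := by
  rw [← mem_lowered_one, ← h.sector_eq_lowered hgen, powerSum_one]
  norm_num

theorem isBasisOf_sector_three (h : HasWeylRelations Ω {a, a, b}) :
    IsBasisOf ![Ω] (sector V 3) := by
  refine ⟨LinearIndependent.of_subsingleton 0 h.ne_zero, ?_⟩
  have := h.sector_eq_lowered hgen 0
  simpa [powerSum_one, lowered] using this.symm

theorem isInternal_sector_four [FiniteDimensional ℂ V] (h : HasWeylRelations Ω {a, a, b}) :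
    DirectSum.IsInternal fun n : Fin 4 => sector V (3 - 2 * ((n : ℕ) : ℂ)) :=
  h.isInternal_sector hgen (N := 3) (powerSum_one _)

theorem isBasisOf_sector_neg_three [FiniteDimensional ℂ V] (h : HasWeylRelations Ω {a, a, b})
    (hab : a ≠ b) :
    IsBasisOf ![⁅lower (linearFactor (b : ℂ)),
      ⁅lower (linearFactor (b : ℂ)), ⁅lower (linearFactor (a : ℂ)), Ω⁆⁆⁆] (sector V (-3)) :=
  (h.isBasisOf_sector_three hgen).sector_neg (n := 3)
    (LinearIndependent.of_subsingleton 0 (h.lower_lower_lower_ne_zero hab))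
    (by simpa using h.lower_lower_lower_mem_sector_neg_three _ _ _)

theorem finrank_eq_sum_finrank_sector [FiniteDimensional ℂ V] (h : HasWeylRelations Ω {a, a, b}) :
    Module.finrank ℂ V = Module.finrank ℂ (sector V 3) + Module.finrank ℂ (sector V 1) +
      Module.finrank ℂ (sector V (-1)) + Module.finrank ℂ (sector V (-3)) := by
  rw [← (LinearEquiv.ofBijective (DirectSum.coeLinearMap
    fun n : Fin 4 => sector V (3 - 2 * ((n : ℕ) : ℂ))) (h.isInternal_sector_four hgen)).finrank_eq,
    Module.finrank_directSum, Fin.sum_univ_four]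
  congr <;> norm_num

section PairNonzero

variable (hw : ⁅lower (linearFactor (a : ℂ) * linearFactor (b : ℂ)), Ω⁆ ≠ 0)

include hw

omit hgen in
theorem isReducible_of_lower_pair_ne_zero (h : HasWeylRelations Ω {a, a, b}) : IsReducible V := by
  refine h.isReducible (h.hasHighestWeight_lower_pair hw) fun n hn => ?_
  rw [powerSum_one, powerSum_one, Multiset.card_singleton, Multiset.card_eq_three.2 ⟨a, a, b, rfl⟩]
    at hn
  have : ((n + 1 : ℕ) : ℂ) = 0 := by
    push_cast
    linear_combination (norm := (push_cast; ring)) hn / 2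
  exact n.succ_ne_zero (Nat.cast_eq_zero.1 this)

theorem isBasisOf_sector_one_of_lower_pair_ne_zero (h : HasWeylRelations Ω {a, a, b})
    (hab : a ≠ b) : IsBasisOf ![⁅lower (linearFactor (b : ℂ)), Ω⁆,
      ⁅lower (linearFactor (a : ℂ)), Ω⁆,
      ⁅lower (linearFactor (a : ℂ) * linearFactor (b : ℂ)), Ω⁆] (sector V 1) := by
  refine ⟨linearIndependent_triple fun x y z h0 => ?_, le_antisymm ?_ fun v hv => ?_⟩
  · obtain ⟨rfl, rfl⟩ := h.coeff_eq_zero_of_sector_one hab h0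
    simpa [hw] using h0
  · simp [Submodule.span_le, Set.insert_subset_iff, h.lower_mem_sector_one]
  · obtain ⟨p, rfl⟩ := (h.mem_sector_one_iff hgen).1 hv
    obtain ⟨x, y, z, hp⟩ := h.exists_lower_eq hab p
    exact (Submodule.mem_span_range_iff_exists_fun ℂ).2
      ⟨![x, y, z], by simpa [Fin.sum_univ_three] using hp⟩

theorem isBasisOf_sector_neg_one_of_lower_pair_ne_zero [FiniteDimensional ℂ V]
    (h : HasWeylRelations Ω {a, a, b}) (hab : a ≠ b) :
    IsBasisOf ![⁅lower (linearFactor (b : ℂ)), ⁅lower (linearFactor (b : ℂ)), Ω⁆⁆,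
      ⁅lower (linearFactor (b : ℂ)), ⁅lower (linearFactor (a : ℂ)), Ω⁆⁆,
      ⁅lower (linearFactor (a : ℂ)), ⁅lower (linearFactor (a : ℂ) * linearFactor (b : ℂ)), Ω⁆⁆]
      (sector V (-1)) := by
  have hAw : ⁅lower (linearFactor (a : ℂ)),
      ⁅lower (linearFactor (a : ℂ) * linearFactor (b : ℂ)), Ω⁆⁆ ≠ 0 := by
    intro h0
    have := (h.hasHighestWeight_lower_pair hw).eq_zero_of_lower_eq_zero h0
    rw [powerSum_apply, Multiset.map_singleton, Multiset.sum_singleton, evalAt_linearFactor,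
      sub_eq_zero, Units.val_inj] at this
    exact hab this.symm
  have hbasis := h.isBasisOf_sector_one_of_lower_pair_ne_zero hgen hw hab
  rw [← Nat.cast_one] at hbasis ⊢
  refine hbasis.sector_neg (linearIndependent_triple fun x y z h0 => ?_) ?_
  · obtain ⟨rfl, rfl⟩ := h.coeff_eq_zero_of_sector_neg_one hab h0
    simpa [hAw] using h0
  · simp [Fin.forall_fin_succ, h.lower_lower_mem_sector_neg_one]

theorem finrank_eq_eight [FiniteDimensional ℂ V] (h : HasWeylRelations Ω {a, a, b}) (hab : a ≠ b) :
    Module.finrank ℂ V = 8 := by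
  rw [h.finrank_eq_sum_finrank_sector hgen, (h.isBasisOf_sector_three hgen).finrank_eq,
    (h.isBasisOf_sector_one_of_lower_pair_ne_zero hgen hw hab).finrank_eq,
    (h.isBasisOf_sector_neg_one_of_lower_pair_ne_zero hgen hw hab).finrank_eq,
    (h.isBasisOf_sector_neg_three hgen hab).finrank_eq]
  rfl

end PairNonzero

section PairZero

variable (hw : ⁅lower (linearFactor (a : ℂ) * linearFactor (b : ℂ)), Ω⁆ = 0)

include hw

theorem isBasisOf_sector_one_of_lower_pair_eq_zero (h : HasWeylRelations Ω {a, a, b})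
    (hab : a ≠ b) : IsBasisOf ![⁅lower (linearFactor (b : ℂ)), Ω⁆,
      ⁅lower (linearFactor (a : ℂ)), Ω⁆] (sector V 1) := by
  refine ⟨LinearIndependent.pair_iff.2 fun x y h0 => ?_, le_antisymm ?_ fun v hv => ?_⟩
  · exact h.coeff_eq_zero_of_sector_one hab (z := 0) (by simpa using h0)
  · simp [Submodule.span_le, Set.insert_subset_iff, h.lower_mem_sector_one]
  · obtain ⟨p, rfl⟩ := (h.mem_sector_one_iff hgen).1 hv
    obtain ⟨x, y, z, hp⟩ := h.exists_lower_eq hab p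
    exact (Submodule.mem_span_range_iff_exists_fun ℂ).2 ⟨![x, y], by simpa [hw] using hp⟩

theorem isBasisOf_sector_neg_one_of_lower_pair_eq_zero [FiniteDimensional ℂ V]
    (h : HasWeylRelations Ω {a, a, b}) (hab : a ≠ b) :
    IsBasisOf ![⁅lower (linearFactor (b : ℂ)), ⁅lower (linearFactor (b : ℂ)), Ω⁆⁆,
      ⁅lower (linearFactor (b : ℂ)), ⁅lower (linearFactor (a : ℂ)), Ω⁆⁆] (sector V (-1)) := by
  have hbasis := h.isBasisOf_sector_one_of_lower_pair_eq_zero hgen hw hab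
  rw [← Nat.cast_one] at hbasis ⊢
  refine hbasis.sector_neg (LinearIndependent.pair_iff.2 fun x y h0 => ?_) ?_
  · exact h.coeff_eq_zero_of_sector_neg_one hab (z := 0) (by simpa using h0)
  · simp [Fin.forall_fin_succ, h.lower_lower_mem_sector_neg_one]

theorem finrank_eq_six [FiniteDimensional ℂ V] (h : HasWeylRelations Ω {a, a, b}) (hab : a ≠ b) :
    Module.finrank ℂ V = 6 := by
  rw [h.finrank_eq_sum_finrank_sector hgen, (h.isBasisOf_sector_three hgen).finrank_eq,
    (h.isBasisOf_sector_one_of_lower_pair_eq_zero hgen hw hab).finrank_eq,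
    (h.isBasisOf_sector_neg_one_of_lower_pair_eq_zero hgen hw hab).finrank_eq,
    (h.isBasisOf_sector_neg_three hgen hab).finrank_eq]
  rfl

theorem eq_zero_of_raise_eq_zero (h : HasWeylRelations Ω {a, a, b}) (hab : a ≠ b) {v : V}
    (hv : v ∈ sector V 1) (hraise : ∀ q, ⁅raise q, v⁆ = 0) : v = 0 := by
  obtain ⟨p, rfl⟩ := (h.mem_sector_one_iff hgen).1 hv
  exact h.lower_eq_zero_of_dvd hw <| linearFactor_mul_dvd_of_evalAt_eq_zero hab
    (h.evalAt_eq_zero_of_raise_lower_eq_zero hraise (by simp))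
    (h.evalAt_eq_zero_of_raise_lower_eq_zero hraise (by simp))

theorem isIrreducible [FiniteDimensional ℂ V] (h : HasWeylRelations Ω {a, a, b}) (hab : a ≠ b) :
    LieModule.IsIrreducible ℂ LSL2 V := by
  have : Nontrivial V := ⟨Ω, 0, h.ne_zero⟩
  refine LieModule.IsIrreducible.mk fun W hW => ?_
  obtain ⟨n, hn, v, hvW, hv0, hv⟩ :=
    h.exists_mem_sector_of_ne_bot hgen (N := 3) (powerSum_one _) hW
  obtain rfl | rfl : n = 0 ∨ n = 1 := by lia
  · refine h.eq_top_of_mem_sector hgen hvW hv0 ?_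
    simpa [powerSum_one] using hv
  · norm_num at hv
    obtain ⟨q, hq⟩ : ∃ q, ⁅raise q, v⁆ ≠ 0 := by
      by_contra! hraise
      exact hv0 (h.eq_zero_of_raise_eq_zero hgen hw hab hv hraise)
    refine h.eq_top_of_mem_sector hgen (W.lie_mem hvW) hq ?_
    convert raise_mem_sector hv q using 2
    norm_num [powerSum_one]

end PairZero

end HasWeylRelations

end DoubleParameter

end

end LoopSL2

theorem mainTheorem4 {V : Type*} [AddCommGroup V] [Module ℂ V]
    [LieRingModule LoopSL2.LSL2 V] [LieModule ℂ LoopSL2.LSL2 V] [FiniteDimensional ℂ V]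
    (Ω : V) (hΩ : LoopSL2.IsHighestWeightVector Ω)
    (hgen : LieSubmodule.lieSpan ℂ LoopSL2.LSL2 {Ω} = ⊤)
    (a₁ a₂ : ℂ) (ha : a₁ ≠ a₂)
    (hA : LoopSL2.HasEvaluationParameters Ω {a₁, a₁, a₂})
    (ρ₁ ρ₂ w₁ : LoopSL2.LSL2)
    (hρ₁ : ρ₁ = LoopSL2.withParams LoopSL2.xm {a₂})
    (hρ₂ : ρ₂ = LoopSL2.withParams LoopSL2.xm {a₁})
    (hw₁ : w₁ = LoopSL2.withParams LoopSL2.xm {a₁, a₂}) :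
    ((LoopSL2.IsReducible V ∧ LoopSL2.IsIndecomposable V ∧ Module.finrank ℂ V = 2 ^ 3) ↔
      ⁅w₁, Ω⁆ ≠ 0) ∧
    ((LieModule.IsIrreducible ℂ LoopSL2.LSL2 V ∧ Module.finrank ℂ V = 6) ↔ ⁅w₁, Ω⁆ = 0) ∧
    DirectSum.IsInternal (fun n : Fin 4 => LoopSL2.sector V (3 - 2 * ((n : ℕ) : ℂ))) ∧
    (⁅w₁, Ω⁆ ≠ 0 →
      LoopSL2.IsBasisOf ![Ω] (LoopSL2.sector V 3) ∧
      LoopSL2.IsBasisOf ![⁅ρ₁, Ω⁆, ⁅ρ₂, Ω⁆, ⁅w₁, Ω⁆] (LoopSL2.sector V 1) ∧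
      LoopSL2.IsBasisOf ![⁅ρ₁, ⁅ρ₁, Ω⁆⁆, ⁅ρ₁, ⁅ρ₂, Ω⁆⁆, ⁅ρ₂, ⁅w₁, Ω⁆⁆]
        (LoopSL2.sector V (-1)) ∧
      LoopSL2.IsBasisOf ![⁅ρ₁, ⁅ρ₁, ⁅ρ₂, Ω⁆⁆⁆] (LoopSL2.sector V (-3))) ∧
    (⁅w₁, Ω⁆ = 0 →
      LoopSL2.IsBasisOf ![Ω] (LoopSL2.sector V 3) ∧
      LoopSL2.IsBasisOf ![⁅ρ₁, Ω⁆, ⁅ρ₂, Ω⁆] (LoopSL2.sector V 1) ∧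
      LoopSL2.IsBasisOf ![⁅ρ₁, ⁅ρ₁, Ω⁆⁆, ⁅ρ₁, ⁅ρ₂, Ω⁆⁆] (LoopSL2.sector V (-1)) ∧
      LoopSL2.IsBasisOf ![⁅ρ₁, ⁅ρ₁, ⁅ρ₂, Ω⁆⁆⁆] (LoopSL2.sector V (-3))) := by
  simp only [LoopSL2.withParams_xm, Multiset.insert_eq_cons, Multiset.map_cons,
    Multiset.map_singleton, Multiset.prod_cons, Multiset.prod_singleton] at hρ₁ hρ₂ hw₁
  subst hρ₁ hρ₂ hw₁
  obtain ⟨d, hd⟩ := hΩ.exists_hasHighestWeight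
  obtain ⟨ha₁, ha₂⟩ : a₁ ≠ 0 ∧ a₂ ≠ 0 := by
    simpa [eq_comm] using hd.zero_notMem_parameters hA
  lift a₁ to ℂˣ using ha₁.isUnit
  lift a₂ to ℂˣ using ha₂.isUnit
  have hab : a₁ ≠ a₂ := ne_of_apply_ne Units.val ha
  have H : LoopSL2.HasWeylRelations Ω {a₁, a₁, a₂} := hd.hasWeylRelations hgen (by simpa using hA)
  have hthree := H.isBasisOf_sector_three hgen
  have hneg_three := H.isBasisOf_sector_neg_three hgen hab
  refine ⟨⟨fun ⟨_, _, hdim⟩ hw => ?_, fun hw => ⟨H.isReducible_of_lower_pair_ne_zero hw,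
      H.isIndecomposable hgen, H.finrank_eq_eight hgen hw hab⟩⟩,
    ⟨fun ⟨_, hdim⟩ => by_contra fun hw => ?_,
      fun hw => ⟨H.isIrreducible hgen hw hab, H.finrank_eq_six hgen hw hab⟩⟩,
    H.isInternal_sector_four hgen,
    fun hw => ⟨hthree, H.isBasisOf_sector_one_of_lower_pair_ne_zero hgen hw hab,
      H.isBasisOf_sector_neg_one_of_lower_pair_ne_zero hgen hw hab, hneg_three⟩,
    fun hw => ⟨hthree, H.isBasisOf_sector_one_of_lower_pair_eq_zero hgen hw hab,
      H.isBasisOf_sector_neg_one_of_lower_pair_eq_zero hgen hw hab, hneg_three⟩⟩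
  · simp [H.finrank_eq_six hgen hw hab] at hdim
  · simp [H.finrank_eq_eight hgen hw hab] at hdim
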